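/- Let $E_2\subset[0,1]$ be the set of irrational numbers whose infinite continued fraction expansion has all its digits equal to $1$ or $2$, that is, $$E_2=\{[0;a_1,a_2,a_3,\ldots] \mid a_n\in\{1,2\}\text{ for all } n\ge 1\}.$$ Let $d$ be the decimal number $$\begin{aligned} d = 0.&5312805062\,7720514162\,4468647368\,4717854930\,5910901839\,8779888397\,8039275295\\ &3564383134\,5918109570\,1811852398\,8042805724\,3075187633\,4223893394\,8082230901\\ &7869596532\,8712235464\,2997948966\,3784033728\,7630454110\,1508045191\,3969768071\,3 . \end{aligned}$$ Then the Hausdorff dimension of $E_2$ satisfies $$d-10^{-201}\;\le\;\dim_H(E_2)\;\le\;d+10^{-201}.$$ -/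

import Mathlib

/-- The set `E₂` of real numbers `[0; a₁, a₂, a₃, …]` whose (simple, regular) continued fraction
expansion is infinite, has integer part `0`, and has all digits `a₁, a₂, …` in `{1, 2}`.
`GenContFract.of x` is the regular continued fraction expansion of `x`; it does not terminate
exactly when the `n`-th partial denominator exists (is `some _`) for every `n`. -/
def E₂ : Set ℝ :=
  {x | (GenContFract.of x).h = 0 ∧
    ∀ n : ℕ, ∃ a ∈ ({1, 2} : Set ℝ), (GenContFract.of x).partDens.get? n = some a}

/-! Let L_s g(t) = (1+t)^(-2s) g(1/(1+t)) + (2+t)^(-2s) g(1/(2+t)). `E₂` is the limit set of the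
branches y ↦ 1/(b+y), b = 1, 2, and its dimension is the s for which L_s has leading eigenvalue 1.
One-sided tests suffice: a positive bounded g on [1/3, 3/4] with L_s g ≤ g gives dimension at most s
(`dimH_le_of_transfer_le`), and g ≤ L_s g gives at least s (`le_dimH_of_le_transfer`). The reason is
a weight on words. If q, q' are the last two convergent denominators, the cylinder has diameter at
most q^(-2), and its two parts are separated by a fixed multiple of q^(-2). Appending a digit b
turns q'/q into 1/(b + q'/q), so the weights q^(-2s) g(q'/q) of the two children add up to q^(-2s)
(L_s g)(q'/q). A subsolution or supersolution therefore makes the weight superadditive or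
subadditive along the tree of words. A single g, `trial`, serves both bounds. It satisfies |g - L_d
g| ≤ 2·10^(-202) g, while moving the exponent by 10^(-201) changes L by a factor of at least 1 +
5·10^(-202), because i + t ≥ 4/3. In the coordinate v = (9t-5)/(t+2), g is (t+2)^(-2d) times a
polynomial P of degree 142, and L_d has weights ((37+v)/23)^(-2d) and ((55-v)/23)^(-2d). With
truncated binomial series for the weights and denominators cleared, the eigenvalue equation compares
integer polynomials; the sum of the absolute coefficients of the difference bounds it on |v| ≤ 1
(`defect_le`, `approx_eigenfunction`). The series themselves are certified by the differential
equation of a power (`abs_eval_sub_rpow_le`). -/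

/-! ### Polynomials with integer coefficients as lists, evaluated strictly by the kernel -/

namespace IntPoly

/-- `k n`, with `n` evaluated before `k` is unfolded. -/
def forceNat {β : Type} (n : ℕ) (k : ℕ → β) : β :=
  -- Recursion on `n` forces it to a literal, so `k` receives a number and not copies of an
  -- unevaluated term.
  Nat.rec (k 0) (fun m _ => k (Nat.succ m)) n

theorem forceNat_eq {β : Type} (n : ℕ) (k : ℕ → β) : forceNat n k = k n := by
  cases n <;> rfl

/-- `k z`, with `z` evaluated before `k` is unfolded. -/
def forceInt {β : Type} (z : ℤ) (k : ℤ → β) : β :=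
  match z with
  | Int.ofNat n => forceNat n fun n => k (Int.ofNat n)
  | Int.negSucc n => forceNat n fun n => k (Int.negSucc n)

theorem forceInt_eq {β : Type} (z : ℤ) (k : ℤ → β) : forceInt z k = k z := by
  cases z with
  | ofNat n => exact forceNat_eq n fun n => k (Int.ofNat n)
  | negSucc n => exact forceNat_eq n fun n => k (Int.negSucc n)

/-- `k l`, with all entries of `l` evaluated before `k` is unfolded. -/
def forceList {β : Type} : List ℤ → (List ℤ → β) → β
  | [], k => k []
  | a :: l, k => forceInt a fun a => forceList l fun l => k (a :: l)

theorem forceList_eq {β : Type} (l : List ℤ) (k : List ℤ → β) : forceList l k = k l := by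
  induction l generalizing k with
  | nil => rfl
  | cons a l ih => rw [forceList, forceInt_eq, ih]

/-- The value at `x` of the polynomial with the coefficients `l`, constant term first. -/
noncomputable def eval (x : ℝ) : List ℤ → ℝ
  | [] => 0
  | a :: l => a + x * eval x l

/-- The sum of the absolute values of the coefficients. -/
def norm : List ℤ → ℕ
  | [] => 0
  | a :: l => forceNat (norm l) fun s => Nat.add a.natAbs s

/-- The sum of the coefficients. -/
def total : List ℤ → ℤ
  | [] => 0
  | a :: l => forceInt (total l) fun s => Int.add a s

theorem eval_one (l : List ℤ) : eval 1 l = total l := by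
  induction l with
  | nil => simp [eval, total]
  | cons a l ih =>
    rw [total, forceInt_eq, eval, ih]
    change _ = (((a + total l : ℤ)) : ℝ)
    push_cast; ring

theorem abs_eval_le {x : ℝ} (hx : |x| ≤ 1) (l : List ℤ) : |eval x l| ≤ norm l := by
  induction l with
  | nil => simp [eval, norm]
  | cons a l ih =>
    have h : ((norm (a :: l) : ℕ) : ℝ) = |(a : ℝ)| + norm l := by
      rw [norm, forceNat_eq]
      simp [Nat.cast_natAbs]
    rw [eval, h]
    calc |(a : ℝ) + x * eval x l| ≤ |(a : ℝ)| + |x * eval x l| := abs_add_le _ _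
      _ ≤ |(a : ℝ)| + norm l := by
        rw [abs_mul]
        have := mul_le_mul hx ih (abs_nonneg _) zero_le_one
        linarith

/-- `c * p + q`. -/
def axpy (c : ℤ) : List ℤ → List ℤ → List ℤ
  | [], q => q
  | a :: p, [] => Int.mul c a :: axpy c p []
  | a :: p, b :: q => Int.add (Int.mul c a) b :: axpy c p q

theorem eval_axpy (x : ℝ) (c : ℤ) (p q : List ℤ) :
    eval x (axpy c p q) = c * eval x p + eval x q := by
  induction p generalizing q with
  | nil => simp [axpy, eval]
  | cons a p ih =>
    cases q with
    | nil =>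
      simp only [axpy, eval, ih]
      change (((c * a : ℤ)) : ℝ) + _ = _
      push_cast; ring
    | cons b q =>
      simp only [axpy, eval, ih]
      change (((c * a + b : ℤ)) : ℝ) + _ = _
      push_cast; ring

/-- `(s + t X) * p`. -/
def mulLinear (s t : ℤ) (p : List ℤ) : List ℤ :=
  axpy s p (0 :: axpy t p [])

theorem eval_mulLinear (x : ℝ) (s t : ℤ) (p : List ℤ) :
    eval x (mulLinear s t p) = (s + t * x) * eval x p := by
  simp only [mulLinear, eval_axpy, eval]
  push_cast; ring

/-- `k (p * q)`. -/
def mulThen {β : Type} : List ℤ → List ℤ → (List ℤ → β) → β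
  | [], _, k => k []
  | a :: p, q, k => mulThen p q fun r => forceList (axpy a q (0 :: r)) k

/-- A single `r` serving all `k` lets later proofs discard the continuation-passing form. -/
theorem mulThen_spec {β : Type} (p q : List ℤ) :
    ∃ r : List ℤ, (∀ x, eval x r = eval x p * eval x q) ∧
      ∀ k : List ℤ → β, mulThen p q k = k r := by
  induction p with
  | nil => exact ⟨[], fun x => by simp [eval], fun k => rfl⟩
  | cons a p ih =>
    obtain ⟨r, hr, hk⟩ := ih
    refine ⟨axpy a q (0 :: r), fun x => ?_, fun k => ?_⟩
    · simp only [eval_axpy, eval, hr]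
      push_cast; ring
    · rw [mulThen, hk, forceList_eq]

/-- `k (∑ᵢ aᵢ (x + y X) ^ i (z + w X) ^ (n - 1 - i)) ((z + w X) ^ n)` for a list of length `n`. -/
def homThen {β : Type} (x y z w : ℤ) : List ℤ → (List ℤ → List ℤ → β) → β
  | [], k => k [] [1]
  | a :: l, k => homThen x y z w l fun acc pw =>
      forceList (axpy a pw (mulLinear x y acc)) fun acc =>
        forceList (mulLinear z w pw) fun pw => k acc pw

theorem homThen_spec {β : Type} (x y z w : ℤ) (l : List ℤ) :
    ∃ acc pw : List ℤ,
      (∀ v : ℝ, (z + w * v : ℝ) ≠ 0 →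
        -- The accumulator is homogeneous of degree `l.length - 1`; the extra factor avoids the
        -- subtraction and covers the empty list.
        eval v acc * (z + w * v) =
          (z + w * v) ^ l.length * eval ((x + y * v) / (z + w * v)) l ∧
        eval v pw = (z + w * v) ^ l.length) ∧
      ∀ k : List ℤ → List ℤ → β, homThen x y z w l k = k acc pw := by
  induction l with
  | nil => exact ⟨[], [1], fun v _ => by simp [eval], fun k => rfl⟩
  | cons a l ih =>
    obtain ⟨acc, pw, h, hk⟩ := ih
    refine ⟨axpy a pw (mulLinear x y acc), mulLinear z w pw, fun v hv => ?_, fun k => ?_⟩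
    · obtain ⟨h1, h2⟩ := h v hv
      constructor
      · rw [eval_axpy, eval_mulLinear, h2, add_mul, mul_assoc ((x : ℝ) + y * v), h1, eval,
          List.length_cons, pow_succ]
        field_simp
      · rw [eval_mulLinear, h2, List.length_cons, pow_succ]
        ring
    · rw [homThen, hk, forceList_eq, forceList_eq]

/-- `[k a₀, (k + 1) a₁, …]`. -/
def derivAux : ℕ → List ℤ → List ℤ
  | _, [] => []
  | k, a :: l => Int.mul (Int.ofNat k) a :: derivAux (Nat.succ k) l

/-- The derivative. -/
def derivative (l : List ℤ) : List ℤ := derivAux 1 l.tail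

/-- The factor x^(k+1) makes the shifted list a genuine polynomial tail, so that the induction on
the list closes. -/
theorem hasDerivAt_derivAux (l : List ℤ) (k : ℕ) (x : ℝ) :
    HasDerivAt (fun x => x ^ (k + 1) * eval x l) (x ^ k * eval x (derivAux (k + 1) l)) x := by
  induction l generalizing k with
  | nil => simpa [derivAux, eval] using hasDerivAt_const x (0 : ℝ)
  | cons a l ih =>
    have h1 : HasDerivAt (fun x : ℝ => x ^ (k + 1) * (a : ℝ)) ((k + 1 : ℕ) * x ^ k * a) x := by
      simpa using (hasDerivAt_pow (k + 1) x).mul_const (a : ℝ)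
    have h := h1.add (ih (k + 1))
    refine (h.congr_deriv ?_).congr_of_eventuallyEq (Filter.Eventually.of_forall fun y => ?_)
    · change _ = x ^ k * ((((Int.ofNat (k + 1) * a : ℤ)) : ℝ) + _)
      push_cast
      simp only [Nat.succ_eq_add_one, Int.ofNat_eq_natCast]
      push_cast
      ring
    · simp only [eval, Pi.add_apply]
      ring

theorem hasDerivAt_eval (l : List ℤ) (x : ℝ) :
    HasDerivAt (fun x => eval x l) (eval x (derivative l)) x := by
  cases l with
  | nil => simpa [derivative, derivAux, eval] using hasDerivAt_const x (0 : ℝ)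
  | cons a l =>
    have h := (hasDerivAt_derivAux l 0 x).const_add (a : ℝ)
    simpa [derivative, eval] using h

/-- Coefficients of an approximation to `b (1 + X / m) ^ (-t / u)`, of degree `n` from `k` on. -/
def binomialAux (m t u : ℤ) : ℕ → ℕ → ℤ → List ℤ
  | 0, _, b => [b]
  -- The ratio of consecutive binomial coefficients is -(t + k u) / (m (k+1) u). The rounding in
  -- `Int.ediv` needs no analysis, since the result is judged only by its residual in the
  -- differential equation.
  | n + 1, k, b => b :: forceInt
      (Int.neg (Int.ediv (Int.mul b (Int.add t (Int.mul (Int.ofNat k) u)))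
        (Int.mul (Int.mul m (Int.ofNat (Nat.succ k))) u)))
      fun b => forceNat (Nat.succ k) fun k => binomialAux m t u n k b

/-- The norm of `u (m + X) p' + t p`. -/
def odeResidual (m t u : ℤ) (p : List ℤ) : ℕ :=
  forceList p fun p => forceList (derivative p) fun d =>
    norm (axpy t p (mulLinear (Int.mul u m) u d))

end IntPoly

/-! ### An approximate eigenfunction of the transfer operator -/

namespace EigenfunctionData

open IntPoly

/-- The coefficients, scaled by `10 ^ 208`, of an approximate eigenfunction. -/
def coeffs : List ℤ := [
  10000000000000000000000000000000000000000000000000000000000000000000000000000000000000000000000000000000000000000000000000000000000000000000000000000000000000000000000000000000000000000000000000000000000000000,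
  -73983915396194741937796620841876728222140544816618120735843349781162806165377364312551848532053633391569680490228772124350541963558062064686980816845406981929174501030309413879663645994538726380417079827330,
  6185851383942906327062747341993405139450139047821524411507573256847470158388903357909930711667531898859243035117776210124105998369912073633014682488906234285424087593294252852388629841709222928142285937681,
  -100145687539575882873934246406071238471072902638602488297300179676509604010603620237136690301389020177271554066650807010223655750042361100984930390281817045985828610731268580138426222070778223445706297376,
  5290439962453280469312981770772773577933629706802302585902708715525186020633344686286043546344949112115089018764534624470074904571448141175626436335363570439528419742891959274706611241759257188793241832,
  -132244255636612183637229282749554313019606464399793650560078631950659501974094208966165769540964374699535018209930233495783680108797740481353613910177142756966649463823694262958957499480860376679657349,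
  5591533779333710969564506679306217800223427882210086654326522605510850391476661680506547835196887067331587291443516741629242598100862192566215370626097361718642385618339382873258103379568687342131234,
  -170327244485884265951245440830334634572750098968093121541842868151718049489652005073459299469005522932079175083917428203049914159754497694052000061889323937227300306382126688951491473539895586073469,
  6526464171472618623819264431151880973270194630153135325916459293387084556596585399471721329355516989407431066067890959825521603558774619508628538299700429180922859571609155752951164877509118962299,
  -216653329660239209223773870186793330528526361719430177393751100273749550760635768601299265969023308074599608525222274728298073055995993946411488701939556261025085155109114673400856985754588538654,
  7957052371920558478176698543303178512359693934920035151443426605965265957944302124240086350777999411355200937129854550997565689498873388325698609045360789553573024553995540173461185798411221003,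
  -274389629587236739490112871173539719744380305270999123203132797877735380128353586669182631543810864991028531991161343229446842984942467833167461692116806264419240990404081095167099077499230858,
  9900960822350613962573873143616547145980330422415521883480704145952898472029063261164150460178863055497402210126398434454120253424584111433645971065768036956158597993424103684761386406637970,
  -347529301390205777071629534529312523687099722742157987181459711719614588990228504802376723093710039825020788113015743194372350227511042695588695304839570549829183817411037236113209541775365,
  12455452203609405277187413456736266777689896228561582063370084630220746536640347558851844165449726498412221849393676118769115308579410226241079084633639349207810363077558432829671761951810,
  -441124235849067836568763561729853161241337085696470126243865860041376751053399733701158860454840086095848689099493949930710183866472776277190000613151746751771765786115082689776592818122,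
  15778849933913330349623220058052943014087297745966418589488878535038296827482053007452071443645109516817987458021309502112282568515836964486941459762038298563973645470554950529972408599,
  -561657614793700073846562157038285745407127704593101959126875929990748076746418465309820980690373553509234105759632818064283814593312290612288632666076276409057882954824496263767338948,
  20092687834797352327903374215353066957179010361303943436116841912409664720548255864889126971438850490749594598415551760986719706436447761675623236079120215007770782205187827470269171,
  -717539264266292923862834168751207566513994921897047033384944393632894856598717965576897210038218111575419499191973769777576942264491132031999428214584476456178094676450464812504349,
  25694342145860533879609823831939504894026948677542106846667732978002364732329384780741260746117444577515254710214689954022689809631091634052194183098891596490859849775006329632719,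
  -919749854541699625654558241506452201268943982508223575343895218974485225574291821298618747832454871989550236019803834021111301844460774001315891263986511048254010044936020012545,
  32977725880278770553999912523048864743638598823531154800774563911690318382147902272404300644411552605062338376810893484127022566861682985195230195170201425907801682322913317988,
  -1182681428112548866596906640350502883749036774611286925130393614795763790164284062033101830534450078247288100802577556101118372995993643395153143537014462098053588102585917566,
  42462409326891480923921933251291845423058507240078383506074232103805681575509123698968359385712301812989453814684721394044161385005174273181495762893428917771029508995946910,
  -1525240379388745530851219481116155987084830563340654293241631975749087139456860349299239894728778614995632507694913846054816449224434745450053300625266689387286772755548129,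
  54832951406872096310750123384696392648450662833864514570217368476632698505882438874119401384272736271697512669897946883453141073633772955439524877790703029451681066896226,
  -1972300790505255776498041875806992155634857536502361033364426881328011484891631058225716202122345114957490225265391929904617230828649189853538907946941580022385287013055,
  70991336137634888917104651243947047755437892061241288136650775036675884390708863724944242904665373013774325226347292127205345954626960916425876704759465120027721272436,
  -2556624222088784628735197007431673158319901412297823066407101103917375491685585539489892694689617678824224997269687957306441346416587360970216994174908175601394760765,
  92126585323589612595208671649602005215596851405780047279448360415536833508428510737433217282022042693356129499636544247448565072944193920485115202490556900550575909,
  -3321399517144890323117218759708635916538350974847492345697832168782630953358680368442117989525614606835873582242936621656311364840111100671902629486179589076059370,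
  119807059434990195863079755829924907150027731916307906011966093947206382812306800536803195182795280133690793673639636090886323140706726698810305271068643747171485,
  -4323606154233383324586642496451735799927807546156798220387676934239889833561975176325944567195148303613509583320775733075544278371950784982312212732332580696680,
  156102820486891269650423772447169441692861292772246611103322196705747173711359824712319511942795605120432096852379190498676663700698704895223748504352045992412,
  -5638471339820154037625488027809507817020671288330390448102199326016997119530805060170606986876509509460687318298754978270957785928013098714734664617803581407,
  203747882983712812974786676231797399631846477977966870279468827503586447314365791064836409668479243136638498353966008030510141244157391572652382634355764755,
  -7365379856170716046718279866860282253543246649711387158599916740590984538843740865049662325486815770217198582533476182556115895212375110328585526066963238,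
  266355431039865404309434893663227834602399903522920612039356889599466533458227006125846341397713336342179729844522565718234638595307384947598759422658896,
  -9635714008705007494829176666656864666390864051889847104907758141484663421120669011494291582900853172501903974289465274407523019308744437902029641699260,
  348703403657772525739429605081245255351113243521634082364608247867038670332930180377904117462614063245082537208322669972310281968133209384904285048655,
  -12623258627073077013953121781155740001462121430755737917266984322591656314129211247714248295529711642048439104659289137594563243177399323364798923938,
  457113605375684927077183399596280746779086544500996866426762361109392809504662209711103943541178283539978622510646941873764264959340374401655512358,
  -16558016022339166347260614581593320323990086760486383457965702130321509799981697629449810488156498621043226001547492561126963834332271998024257808,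
  599955164109543687789053914681489528558415802154165629321194432014165935667057439905902650919971336727473658330465982511639342186948907183774209,
  -21744555509144029551006116968912309405819567388168683446256316947628494741284160638078807560829751268538517203077654499207593087961270508057668,
  788313368942023258129766648009233195206130005233649485337115921079578801937270494818439737295036671382790802492911597952316271353609974817412,
  -28586394811220553773083173117143814793689596805421615976770838853895837622920762563427610114483710372833349797978829299915200678449772414557,
  1036878527273354849488690128312875254528411766655256155482432891062838087837892537936252263299795046058921257365346575231904187257588960194,
  -37618407398216242419293644073454445215665436990614441215144350060503957966920272206369657631312389065771515023209689583900439170452059090,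
  1365127616373642510861868174322208469400418022671590864859287126502654084738134543199782458768703004884680449526959840417499699562234006,
  -49549911943292978227839335353646589620580202071144313705667479824144018083659554642089838052549101960244807467513720679998702298858128,
  1798895681191715507461915523622681294414266470723055558559245876102596586347910262025290023849513929110511158967433570689481218788862,
  -65321982887283318548376341617718697855412568696561647877692009961321394510252962768416620115274870061202511736347342187139598930880,
  2372466166585829187478520321883012392671251090704125395655225495578059556987692751144458133005328680566754417520601942998561893673,
  -86183698283514421083809831114286825434065104407792845343039802444199145689252579852602637469106381832925364079250669455569330964,
  3131352362059478674044505318101299762435317113382183701317874015384060510061130348802287801543793954732762695580615015662525980,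
  -113793611112238247756101334165973127927479988629126595205324023143497835134212269441276024234364165176908103136917149127860651,
  4135999477257972439066641415515972675326533580070618385715576664998471993366051965319143509978391355416745569290687536284470,
  -150354824513292806144853240934919075837468863283553653805237682290821150158256654683435714989846595330298796216364404973190,
  5466713358983950966517293503965880907770527559351111045896191913789746698257092417555030977203180565117542083637260886666,
  -198794845363677116823804183357761046179592452046702086253486878456879881157521859083065433279927701442584043932827916695,
  7230223917516456398117239944273801872504224347589965186313201083865657434885234251000745451770911022722077530844236994,
  -263005118644498295851990525657833568060165668015290622795851972156612795120498166887838091856769310384064503925130649,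
  9568427514615862109433440748085740678999553439483061752326633583823306867122765471495570209401687495521444781632275,
  -348160120034837036983133339596725996733420224771626702617204372335153510049919099778396879955750132102277008145154,
  12670034314237842399181561848560958638165996711858388439825723549357131968578644081756692575386921477365607475969,
  -461142524102620157415051564316611604993984659774566168233520386276572826342197277115277443802631995006633818341,
  16786089185179251015252511429004508257706524376894024846418322384998982740632157596841488096293747095918966011,
  -611109828627655220711767362548887376594544049391696780337572260863351039990401344611045245870304664247744301,
  22250658577703205418059783271842026861482739050284611743372528432830644214311539265986467945494713198652873,
  -810249647790453891387984971946656255685683851875474319233973827014748154245435735628163417116097616089012,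
  29508408133069143838385620087236687654000783006514681449111943702555364453125641242721402208180783579373,
  -1074786684559438231106569001718643960997342418530291933249875446170998937145902722901610851107906790388,
  39151373045040502641614395507538199829350739852962214574562560429977644960179903881914704295680951990,
  -1426325486829575053537614906871293404520756910257688575145315286444018225450808392532215891236048485,
  51967994036513551797829835762019677277406655182115711574789743460387612310115462020151036757916729,
  -1893641261452830922683362062512884801957138716242889455967389529826289142589257882557770632672223,
  69008521263983778510373512707947358280708400922061397453819470417177750373113036311584806748737,
  -2515068642144214742178071229884875069448864519310880106647539131187186879072081692311228765413,
  91672263407260705844587737201628401592675502833426563130575896281748975705540330590976588146,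
  -3341688557739828585931776107721476873087486210399489633552320723711992180159678526358819233,
  121823995761886618688448942938787540296168561704417392935077241501546897487528365912083168,
  -4441580471531885086761207515657811897311392052026437743406121766570902288713924548465229,
  161949294521593672469628703050049682262673592446726167080613240289337604089114092596412,
  -5905496934167813016821557236501446155051787071789175667365268940410828214227260894489,
  215361842048047444434172844707576332405501938646675420010770006326003014313555231054,
  -7854437195551958892542838691305977746059336530914345906605433388206562547776392104,
  286480127039367257102304031584943520173243477220376240042115075520126633670340062,
  -10449756692445980316397576206746087757258540690826562328944009859085003227209146,
  381196814757995195794432807501843257580989441764751587383846754241182371856489,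
  -13906663119109384572867203688679253659268927445614919406519087438657704419493,
  507371881327109735981625803548280989716718437547459461003769697927415010785,
  -18512235614147532188594105986114056161361718901583944513394119371886993955,
  675491054933725197917069799549878788435595307326176376022742867366064185,
  -24649485577161596851958055516169981051539831234248925891749962854041783,
  899545071160864258613788383289484942289695647706383432818765114035700,
  -32829488144981711242862881936257193407188382009808028784630264962622,
  1198203913646400223840319316235009164595977669346042435619812327024,
  -43734295704680852475697444684223843191894722370679279102947505907,
  1596385157994190531534763739804766266606053375746311715475870986,
  -58274256890508683021166631461601704788343966657508365564446629,
  2127348883272689172171858541607712861377328137486294009287473,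
  -77664583715610916438094644521952071756926188918092670785921,
  2835496192312300878160965474381202822935194916366281116965,
  -103527639344560484749314937608186983385765760777042125002,
  3780107974884733944378491649446024862829571115438830190,
  -138029597953546579949833186186986775146873922102351459,
  5040340219213666286931233809544309834592318517001042,
  -184063041287500526370891866654225846170808954772187,
  6721898697631419803156872368029459318148146023363,
  -245490951510394444438407845711048448910173522703,
  8965958276691355895437031199209531269355440006, -327472767916444727153961249462548112565881794,
  11961082541816729038660466764779970370802625, -436900138957647909758804327022130792943372,
  15959154080764696042347423496887485759115, -582979313297075355909730953159552995813,
  21296666306630868274007333273602558010, -778009566687280880482540806503048298,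
  28423183103516134983688658023081094, -1038423715455130793455592846777678,
  37939381617377272135969814370449, -1386179040293508124386695939733,
  50647908056199909524352964124, -1850616732910396179929694809, 67621365791442693566078648,
  -2470947820658650969936733, 90293212189853340445566, -3299576815723700179457,
  120579289635691477577, -4406545618101205122, 161040323274744626, -5885475552724640,
  215099205417986, -7861512971868, 287331551711, -10501954484, 383854255, -14030456, 512845,
  -18746, 685]

/-- `10 ^ 211` times the asserted dimension `d`. -/
def dimNum : ℤ := 5312805062772051416244686473684717854930591090183987798883978039275295356438313459181095701811852398804280572430751876334223893394808223090178695965328712235464299794896637840337287630454110150804519139697680713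

/-- `(37 / 23) ^ (-2 d)`, scaled by `10 ^ 214`. -/
def kappa₁ : ℤ := 6034049887406930556727740817342978004121200867739078471046271099022434781319826349738074395099887176898301888584584820931711863085929085467681514238534584855276833011753120413295497606186914592543207421815324755576

/-- `(55 / 23) ^ (-2 d)`, scaled by `10 ^ 214`. -/
def kappa₂ : ℤ := 3959837523425743702350265242348528823379375471179854609822109285483815386838907184300104015505465889275030489427174279466233613985954997689159777958530965270014996583447132506569072319734637854378699419117166208908

/-- Coefficients approximating `(1 + X / m) ^ (-2 d)`, scaled by `10 ^ 214`. -/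
def power (m : ℤ) : List ℤ := binomialAux m (2 * dimNum) (10 ^ 211) 285 0 (10 ^ 214)

/-- Coefficients approximating `(37 / 23) ^ (-2 d) (1 + X / 37) ^ (-2 d - 142)`. -/
def weight₁ : List ℤ := binomialAux 37 (2 * dimNum + 142 * 10 ^ 211) (10 ^ 211) 225 0 kappa₁

/-- Coefficients approximating `(55 / 23) ^ (-2 d) (1 - X / 55) ^ (-2 d - 142)`. -/
def weight₂ : List ℤ := binomialAux (-55) (2 * dimNum + 142 * 10 ^ 211) (10 ^ 211) 225 0 kappa₂

/-- The norm of the defect in the eigenvalue equation, scaled by `10 ^ 422 * 2035 ^ 142`. -/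
def defect : ℕ :=
  forceList coeffs fun a =>
    homThen 11 (-14) 37 1 a fun q₁ _ =>
      homThen (-34) (-9) 55 (-1) a fun q₂ _ =>
        forceList weight₁ fun b₁ => forceList weight₂ fun b₂ =>
          mulThen b₁ q₁ fun w₁ => mulThen b₂ q₂ fun w₂ =>
            -- Multiplying the equation by 2035^142 = 37^142 · 55^142 clears both denominators;
            -- `coeffs` lacks the factor 10^214 that the weights carry.
            norm (axpy (2035 ^ 142 * 10 ^ 214) a (axpy (-55 ^ 142) w₁ (axpy (-37 ^ 142) w₂ [])))

/-! ### Integer certificates -/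

theorem odeResidual_power :
    ∀ m ∈ [6, 7, 8, 23, 36, 54],
      odeResidual m (2 * dimNum) (10 ^ 211) (power m) ≤ 10 ^ 217 := by
  decide +kernel

theorem odeResidual_weight₁ :
    odeResidual 37 (2 * dimNum + 142 * 10 ^ 211) (10 ^ 211) weight₁ ≤ 10 ^ 217 := by
  decide +kernel

theorem odeResidual_weight₂ :
    odeResidual (-55) (2 * dimNum + 142 * 10 ^ 211) (10 ^ 211) weight₂ ≤ 10 ^ 217 := by
  decide +kernel

theorem abs_total_power_le :
    ∀ m ∈ [6, 7, 8, 23, 36, 54], (total (power m)).natAbs ≤ 10 ^ 214 := by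
  decide +kernel

/-- 37/23 = (37/36)(24/23)(9/8)(8/7)(7/6), a product of factors 1 + 1/m whose binomial series
converge fast. Five scaled factors face one scaled constant, hence the fourth power; the bound is
one unit in the last digit of `kappa₁`. -/
theorem kappa₁_approx :
    (total (power 36) * (total (power 23) * (total (power 8) * (total (power 7) *
      total (power 6)))) - kappa₁ * (10 ^ 214) ^ 4).natAbs ≤ (10 ^ 214) ^ 4 := by
  decide +kernel

theorem kappa₂_approx :
    (total (power 54) * (total (power 23) * (total (power 8) * (total (power 7) *
      (total (power 6) * (total (power 8) * (total (power 7) * total (power 6))))))) -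
        kappa₂ * (10 ^ 214) ^ 7).natAbs ≤ (10 ^ 214) ^ 7 := by
  decide +kernel

theorem length_coeffs : coeffs.length = 143 := by
  decide +kernel

theorem norm_tail_coeffs : coeffs.headD 0 = 10 ^ 208 ∧ norm coeffs.tail ≤ 10 ^ 206 := by
  decide +kernel

theorem defect_le : defect ≤ 10 ^ (422 - 205) * 2035 ^ 142 := by
  decide +kernel

end EigenfunctionData

/-! ### From integer certificates to real estimates -/

namespace IntPoly

theorem abs_ode_le (m t u : ℤ) (p : List ℤ) {x : ℝ} (hx : |x| ≤ 1) :
    |t * eval x p + (u * m + u * x) * eval x (derivative p)| ≤ odeResidual m t u p := by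
  have h := abs_eval_le hx (axpy t p (mulLinear (Int.mul u m) u (derivative p)))
  rw [eval_axpy, eval_mulLinear] at h
  rw [odeResidual, forceList_eq, forceList_eq]
  change |_ + (((u * m : ℤ) : ℝ) + _) * _| ≤ _ at h
  push_cast at h
  exact h

theorem eval_zero_eq (p : List ℤ) : eval 0 p = p.headD 0 := by
  cases p <;> simp [eval]

theorem headD_binomialAux (m t u : ℤ) (n k : ℕ) (b : ℤ) :
    (binomialAux m t u n k b).headD 0 = b := by
  cases n <;> rfl

/-- A polynomial that nearly solves the differential equation of `(1 + x / m) ^ (-t / u)`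
is close to a multiple of this function. -/
theorem abs_eval_sub_rpow_le {m t u : ℤ} {p : List ℤ} {K r : ℝ} (hm : 1 < |(m : ℝ)|)
    (hu : 0 < (u : ℝ)) (hut : (u : ℝ) ≤ t)
    (hK : (|(m : ℝ)| / (|(m : ℝ)| - 1)) ^ ((t : ℝ) / u) ≤ K)
    (hr : (odeResidual m t u p : ℝ) ≤ r) {v : ℝ} (hv : |v| ≤ 1) :
    |eval v p - eval 0 p * (1 + v / m) ^ (-((t : ℝ) / u))| ≤ K ^ 2 * (r / (u * |(m : ℝ)|)) := by
  set T : ℝ := (t : ℝ) / u with hT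
  have hT1 : 1 ≤ T := (one_le_div hu).2 hut
  have hm0 : (m : ℝ) ≠ 0 := by
    intro h; rw [h, abs_zero] at hm; linarith
  have hmpos : 0 < |(m : ℝ)| := abs_pos.2 hm0
  have hq1 : 1 ≤ |(m : ℝ)| / (|(m : ℝ)| - 1) := by
    rw [one_le_div (by linarith)]; linarith
  have hxm : ∀ x : ℝ, |x| ≤ 1 → |x / m| ≤ 1 / |(m : ℝ)| := fun x hx => by
    rw [abs_div]; gcongr
  have hlow : ∀ x : ℝ, |x| ≤ 1 → (|(m : ℝ)| / (|(m : ℝ)| - 1))⁻¹ ≤ 1 + x / m := fun x hx => by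
    have h := (abs_le.1 (hxm x hx)).1
    have h2 : (|(m : ℝ)| / (|(m : ℝ)| - 1))⁻¹ = 1 - 1 / |(m : ℝ)| := by
      rw [inv_div]; field_simp
    rw [h2]; linarith
  have hup : ∀ x : ℝ, |x| ≤ 1 → 1 + x / m ≤ |(m : ℝ)| / (|(m : ℝ)| - 1) := fun x hx => by
    have h := (abs_le.1 (hxm x hx)).2
    have h2 : 1 + 1 / |(m : ℝ)| ≤ |(m : ℝ)| / (|(m : ℝ)| - 1) := by
      rw [le_div_iff₀ (by linarith), add_mul, one_mul, div_mul_eq_mul_div, one_mul, sub_div,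
        div_self hmpos.ne']
      have : 0 < 1 / |(m : ℝ)| := by positivity
      linarith
    linarith
  have hpos : ∀ x : ℝ, |x| ≤ 1 → 0 < 1 + x / m := fun x hx =>
    lt_of_lt_of_le (by positivity) (hlow x hx)
  have hr0 : 0 ≤ r := le_trans (Nat.cast_nonneg _) hr
  have hK0 : 0 ≤ K := le_trans (by positivity) hK
  have hK1 : (|(m : ℝ)| / (|(m : ℝ)| - 1)) ^ (T - 1) ≤ K :=
    le_trans (Real.rpow_le_rpow_of_exponent_le hq1 (by linarith)) hK
  set ρ := r / (u * |(m : ℝ)|) with hρ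
  have hρ0 : 0 ≤ ρ := by positivity
  -- `h` would be constant for an exact solution. In general its derivative is (1+x/m)^(T-1) times
  -- the residual over u m, and the mean value inequality from 0 applies. One factor `K` bounds this
  -- power, the other the final division by (1+v/m)^T.
  let h : ℝ → ℝ := fun x => eval x p * (1 + x / m) ^ T
  let h' : ℝ → ℝ := fun x => (1 + x / m) ^ (T - 1) *
    ((t * eval x p + (u * m + u * x) * eval x (derivative p)) / (u * m))
  have hd : ∀ x ∈ Set.Icc (-1 : ℝ) 1, HasDerivWithinAt h (h' x) (Set.Icc (-1) 1) x := by
    intro x hx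
    have hx1 : |x| ≤ 1 := abs_le.2 hx
    have hp := hpos x hx1
    have h1 : HasDerivAt (fun x : ℝ => 1 + x / m) (1 / m) x :=
      ((hasDerivAt_id x).div_const _).const_add 1
    have h2 := h1.rpow_const (p := T) (Or.inl hp.ne')
    have h3 := (hasDerivAt_eval p x).mul h2
    refine (h3.congr_deriv ?_).hasDerivWithinAt
    have h4 : (1 + x / m) ^ T = (1 + x / m) ^ (T - 1) * (1 + x / m) := by
      rw [← Real.rpow_add_one hp.ne', sub_add_cancel]
    have h5 : (t : ℝ) = T * u := by rw [hT]; field_simp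
    simp only [h', h4, h5]
    field_simp
    ring
  have hb : ∀ x ∈ Set.Icc (-1 : ℝ) 1, ‖h' x‖ ≤ K * ρ := by
    intro x hx
    have hx1 : |x| ≤ 1 := abs_le.2 hx
    have hp := hpos x hx1
    rw [Real.norm_eq_abs, abs_mul, abs_of_pos (Real.rpow_pos_of_pos hp _), abs_div, abs_mul,
      abs_of_pos hu]
    refine mul_le_mul ?_ ?_ (by positivity) hK0
    · exact le_trans (Real.rpow_le_rpow hp.le (hup x hx1) (by linarith)) hK1
    · rw [hρ]
      gcongr
      exact (abs_ode_le m t u p hx1).trans hr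
  have h0 : (0 : ℝ) ∈ Set.Icc (-1 : ℝ) 1 := by constructor <;> norm_num
  have hmv := (convex_Icc (-1 : ℝ) 1).norm_image_sub_le_of_norm_hasDerivWithin_le hd hb h0
    (abs_le.1 hv)
  have hmv2 : |h v - h 0| ≤ K * ρ := by
    refine le_trans (by simpa using hmv) ?_
    exact mul_le_of_le_one_right (by positivity) hv
  have hvp := hpos v hv
  have e0 : h 0 = eval 0 p := by simp [h]
  have e1 : eval v p - eval 0 p * (1 + v / m) ^ (-T) = (h v - h 0) * (1 + v / m) ^ (-T) := by
    rw [e0]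
    simp only [h]
    rw [sub_mul, mul_assoc, ← Real.rpow_add hvp, add_neg_cancel, Real.rpow_zero, mul_one]
  rw [e1, abs_mul, abs_of_pos (Real.rpow_pos_of_pos hvp _)]
  have h6 : (1 + v / m) ^ (-T) ≤ K := by
    rw [Real.rpow_neg hvp.le, ← Real.inv_rpow hvp.le]
    refine le_trans (Real.rpow_le_rpow (inv_nonneg.2 hvp.le) ?_ (by linarith)) hK
    exact inv_le_of_inv_le₀ (by positivity) (hlow v hv)
  calc |h v - h 0| * (1 + v / m) ^ (-T) ≤ K * ρ * K :=
        mul_le_mul hmv2 h6 (Real.rpow_pos_of_pos hvp _).le (by positivity)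
    _ = K ^ 2 * ρ := by ring

end IntPoly

/-- For factors of modulus at most 1 errors add, so a product of several powers loses at most one
decimal digit. -/
theorem abs_mul_sub_mul_le {a b x y δ ε : ℝ} (ha : |a| ≤ 1) (hy : |y| ≤ 1) (h₁ : |a - x| ≤ δ)
    (h₂ : |b - y| ≤ ε) : |a * b - x * y| ≤ δ + ε := by
  have e : a * b - x * y = a * (b - y) + (a - x) * y := by ring
  rw [e]
  refine (abs_add_le _ _).trans ?_
  rw [abs_mul, abs_mul]
  have := mul_le_mul ha h₂ (abs_nonneg _) zero_le_one
  have := mul_le_mul h₁ hy (abs_nonneg _) ((abs_nonneg _).trans h₁)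
  linarith

namespace EigenfunctionData

open IntPoly

/-- The asserted dimension. -/
noncomputable def dimValue : ℝ := (dimNum : ℝ) / 10 ^ 211

theorem dimValue_bounds : 1 / 2 ≤ dimValue ∧ dimValue ≤ 3 / 5 := by
  unfold dimValue dimNum
  constructor <;> norm_num

theorem power_approx {m : ℤ} (hm : m ∈ [6, 7, 8, 23, 36, 54]) :
    |(total (power m) : ℝ) / 10 ^ 214 - (1 + 1 / (m : ℝ)) ^ (-(2 * dimValue))| ≤ 1 / 10 ^ 208 := by
  have hm6 : (6 : ℝ) ≤ m := by
    have : (6 : ℤ) ≤ m := by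
      simp only [List.mem_cons, List.not_mem_nil, or_false] at hm
      omega
    exact_mod_cast this
  have hT : ((2 * dimNum : ℤ) : ℝ) / ((10 ^ 211 : ℤ) : ℝ) = 2 * dimValue := by
    unfold dimValue; push_cast; ring
  have h := abs_eval_sub_rpow_le (m := m) (t := 2 * dimNum) (u := 10 ^ 211) (p := power m)
    (K := 2) (r := 10 ^ 217) (v := 1) (by rw [abs_of_nonneg (by linarith)]; linarith)
    (by norm_num) (by unfold dimNum; norm_num) ?_ (by exact_mod_cast odeResidual_power m hm)
    (by norm_num)
  · rw [hT, eval_one, eval_zero_eq, power, headD_binomialAux, ← power,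
      abs_of_nonneg (by linarith : (0 : ℝ) ≤ m)] at h
    have e : (total (power m) : ℝ) / 10 ^ 214 - (1 + 1 / (m : ℝ)) ^ (-(2 * dimValue)) =
        ((total (power m) : ℝ) - ((10 ^ 214 : ℤ) : ℝ) * (1 + 1 / (m : ℝ)) ^ (-(2 * dimValue))) /
          10 ^ 214 := by
      rw [sub_div, Int.cast_pow, Int.cast_ofNat, mul_div_cancel_left₀ _ (by positivity)]
    rw [e, abs_div, abs_of_pos (by positivity : (0 : ℝ) < 10 ^ 214), div_le_iff₀ (by positivity)]
    refine h.trans ?_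
    have : (10 : ℝ) ^ 217 / (((10 ^ 211 : ℤ) : ℝ) * m) ≤ 10 ^ 217 / (((10 ^ 211 : ℤ) : ℝ) * 6) := by
      gcongr
    refine (mul_le_mul_of_nonneg_left this (by norm_num)).trans ?_
    norm_num
  · rw [hT, abs_of_nonneg (by linarith)]
    have h1 : (m : ℝ) / (m - 1) ≤ 6 / 5 := by
      rw [div_le_div_iff₀ (by linarith) (by norm_num)]; linarith
    have h2 : (1 : ℝ) ≤ m / (m - 1) := by
      rw [one_le_div (by linarith)]; linarith
    calc ((m : ℝ) / (m - 1)) ^ (2 * dimValue) ≤ (m / (m - 1)) ^ (2 : ℝ) :=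
          Real.rpow_le_rpow_of_exponent_le h2 (by linarith [dimValue_bounds.2])
      _ = (m / (m - 1)) ^ 2 := Real.rpow_two _
      _ ≤ (6 / 5) ^ 2 := by gcongr
      _ ≤ 2 := by norm_num

theorem abs_total_power_div_le {m : ℤ} (hm : m ∈ [6, 7, 8, 23, 36, 54]) :
    |(total (power m) : ℝ) / 10 ^ 214| ≤ 1 := by
  rw [abs_div, abs_of_pos (by positivity : (0 : ℝ) < 10 ^ 214), div_le_one (by positivity)]
  have h := abs_total_power_le m hm
  rw [← Int.cast_abs, Int.abs_eq_natAbs]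
  exact_mod_cast h

theorem abs_rpow_neg_le_one {x : ℝ} (hx : 1 ≤ x) : |x ^ (-(2 * dimValue))| ≤ 1 := by
  rw [abs_of_pos (Real.rpow_pos_of_pos (by linarith) _)]
  exact Real.rpow_le_one_of_one_le_of_nonpos hx (by linarith [dimValue_bounds.1])

theorem power_mul_approx {m : ℤ} (hm : m ∈ [6, 7, 8, 23, 36, 54]) {b y δ : ℝ} (hy : 1 ≤ y)
    (h : |b - y ^ (-(2 * dimValue))| ≤ δ) :
    |(total (power m) : ℝ) / 10 ^ 214 * b - ((1 + 1 / (m : ℝ)) * y) ^ (-(2 * dimValue))| ≤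
      1 / 10 ^ 208 + δ := by
  have hm6 : (0 : ℝ) ≤ m := by
    have : (0 : ℤ) ≤ m := by
      simp only [List.mem_cons, List.not_mem_nil, or_false] at hm
      omega
    exact_mod_cast this
  rw [Real.mul_rpow (by positivity) (by linarith)]
  exact abs_mul_sub_mul_le (abs_total_power_div_le hm) (abs_rpow_neg_le_one hy)
    (power_approx hm) h

theorem kappa₁_error :
    |(kappa₁ : ℝ) / 10 ^ 214 - (37 / 23 : ℝ) ^ (-(2 * dimValue))| ≤ 1 / 10 ^ 207 := by
  have h6 := power_approx (m := 6) (by simp)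
  have h7 := power_mul_approx (m := 7) (by simp) (by norm_num) h6
  have h8 := power_mul_approx (m := 8) (by simp) (by norm_num) h7
  have h23 := power_mul_approx (m := 23) (by simp) (by norm_num) h8
  have h36 := power_mul_approx (m := 36) (by simp) (by norm_num) h23
  have e : (1 + 1 / ((36 : ℤ) : ℝ)) * ((1 + 1 / ((23 : ℤ) : ℝ)) * ((1 + 1 / ((8 : ℤ) : ℝ)) *
      ((1 + 1 / ((7 : ℤ) : ℝ)) * (1 + 1 / ((6 : ℤ) : ℝ))))) = 37 / 23 := by norm_num
  rw [e] at h36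
  have hk : |((total (power 36) * (total (power 23) * (total (power 8) * (total (power 7) *
      total (power 6)))) - kappa₁ * (10 ^ 214) ^ 4 : ℤ) : ℝ)| ≤ ((10 : ℝ) ^ 214) ^ 4 := by
    rw [← Int.cast_abs, Int.abs_eq_natAbs]
    exact_mod_cast kappa₁_approx
  generalize total (power 36) = a at *
  generalize total (power 23) = b at *
  generalize total (power 8) = c at *
  generalize total (power 7) = f at *
  generalize total (power 6) = g at *
  generalize kappa₁ = k at *
  generalize (37 / 23 : ℝ) ^ (-(2 * dimValue)) = y at *
  simp only [Int.cast_sub, Int.cast_mul, Int.cast_pow, Int.cast_ofNat] at hk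
  have hS : (0 : ℝ) < 10 ^ 214 := by positivity
  -- Five series errors, plus the rounding of `kappa₁` itself.
  have hS5 : 5 * (1 / 10 ^ 208) + 1 / (10 : ℝ) ^ 214 ≤ 1 / 10 ^ 207 := by norm_num
  generalize (10 : ℝ) ^ 214 = S at *
  have e2 : (k : ℝ) / S - y = ((a : ℝ) / S * (b / S * (c / S *
      (f / S * (g / S)))) - y) - (a * (b * (c * (f * g))) - k * S ^ 4) /
        S ^ 5 := by
    field_simp; ring
  have h9 : |((a : ℝ) * (b * (c * (f * g))) - k * S ^ 4) / S ^ 5| ≤ 1 / S := by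
    rw [abs_div, abs_of_pos (by positivity : (0 : ℝ) < S ^ 5),
      div_le_div_iff₀ (by positivity) hS, one_mul, pow_succ S 4]
    exact mul_le_mul_of_nonneg_right hk hS.le
  rw [e2]
  exact (abs_sub _ _).trans ((add_le_add h36 h9).trans (by linarith))

theorem kappa₂_error :
    |(kappa₂ : ℝ) / 10 ^ 214 - (55 / 23 : ℝ) ^ (-(2 * dimValue))| ≤ 1 / 10 ^ 207 := by
  have h1 := power_approx (m := 6) (by simp)
  have h2 := power_mul_approx (m := 7) (by simp) (by norm_num) h1
  have h3 := power_mul_approx (m := 8) (by simp) (by norm_num) h2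
  have h4 := power_mul_approx (m := 6) (by simp) (by norm_num) h3
  have h5 := power_mul_approx (m := 7) (by simp) (by norm_num) h4
  have h6 := power_mul_approx (m := 8) (by simp) (by norm_num) h5
  have h7 := power_mul_approx (m := 23) (by simp) (by norm_num) h6
  have h8 := power_mul_approx (m := 54) (by simp) (by norm_num) h7
  have e : (1 + 1 / ((54 : ℤ) : ℝ)) * ((1 + 1 / ((23 : ℤ) : ℝ)) * ((1 + 1 / ((8 : ℤ) : ℝ)) *
      ((1 + 1 / ((7 : ℤ) : ℝ)) * ((1 + 1 / ((6 : ℤ) : ℝ)) * ((1 + 1 / ((8 : ℤ) : ℝ)) *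
      ((1 + 1 / ((7 : ℤ) : ℝ)) * (1 + 1 / ((6 : ℤ) : ℝ)))))))) = 55 / 23 := by norm_num
  rw [e] at h8
  have hk : |((total (power 54) * (total (power 23) * (total (power 8) * (total (power 7) *
      (total (power 6) * (total (power 8) * (total (power 7) * total (power 6))))))) -
        kappa₂ * (10 ^ 214) ^ 7 : ℤ) : ℝ)| ≤ ((10 : ℝ) ^ 214) ^ 7 := by
    rw [← Int.cast_abs, Int.abs_eq_natAbs]
    exact_mod_cast kappa₂_approx
  generalize total (power 54) = a at *
  generalize total (power 23) = b at *
  generalize total (power 8) = c at *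
  generalize total (power 7) = f at *
  generalize total (power 6) = g at *
  generalize kappa₂ = k at *
  generalize (55 / 23 : ℝ) ^ (-(2 * dimValue)) = y at *
  simp only [Int.cast_sub, Int.cast_mul, Int.cast_pow, Int.cast_ofNat] at hk
  have hS : (0 : ℝ) < 10 ^ 214 := by positivity
  have hS5 : 8 * (1 / 10 ^ 208) + 1 / (10 : ℝ) ^ 214 ≤ 1 / 10 ^ 207 := by norm_num
  generalize (10 : ℝ) ^ 214 = S at *
  have e2 : (k : ℝ) / S - y = ((a : ℝ) / S * (b / S * (c / S *
      (f / S * (g / S * (c / S * (f / S * (g / S)))))))  - y) -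
        (a * (b * (c * (f * (g * (c * (f * g)))))) - k * S ^ 7) / S ^ 8 := by
    field_simp; ring
  have h9 : |((a : ℝ) * (b * (c * (f * (g * (c * (f * g)))))) - k * S ^ 7) / S ^ 8| ≤ 1 / S := by
    rw [abs_div, abs_of_pos (by positivity : (0 : ℝ) < S ^ 8),
      div_le_div_iff₀ (by positivity) hS, one_mul, pow_succ S 7]
    exact mul_le_mul_of_nonneg_right hk hS.le
  rw [e2]
  exact (abs_sub _ _).trans ((add_le_add h8 h9).trans (by linarith))

/-- The error of a truncated binomial series whose leading coefficient is only known
approximately. -/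
theorem weight_error {m : ℤ} {p : List ℤ} {κ : ℝ} {k : ℤ} (hm : 37 ≤ |(m : ℝ)|)
    (hp : p.headD 0 = k)
    (hr : odeResidual m (2 * dimNum + 142 * 10 ^ 211) (10 ^ 211) p ≤ 10 ^ 217)
    (hk : |(k : ℝ) / 10 ^ 214 - κ| ≤ 1 / 10 ^ 207) {v : ℝ} (hv : |v| ≤ 1) :
    |eval v p / 10 ^ 214 - κ * (1 + v / m) ^ (-(2 * dimValue + 142))| ≤ 1 / 10 ^ 205 := by
  have hT : ((2 * dimNum + 142 * 10 ^ 211 : ℤ) : ℝ) / ((10 ^ 211 : ℤ) : ℝ) =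
      2 * dimValue + 142 := by
    unfold dimValue
    simp only [Int.cast_add, Int.cast_mul, Int.cast_pow, Int.cast_ofNat]
    rw [add_div, mul_div_cancel_right₀ _ (by positivity), mul_div_assoc]
  have hq : |(m : ℝ)| / (|(m : ℝ)| - 1) ≤ 37 / 36 := by
    rw [div_le_div_iff₀ (by linarith) (by norm_num)]; linarith
  have hq1 : 1 ≤ |(m : ℝ)| / (|(m : ℝ)| - 1) := by
    rw [one_le_div (by linarith)]; linarith
  have hK : (|(m : ℝ)| / (|(m : ℝ)| - 1)) ^ (2 * dimValue + 142) ≤ 60 := by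
    calc (|(m : ℝ)| / (|(m : ℝ)| - 1)) ^ (2 * dimValue + 142)
        ≤ (|(m : ℝ)| / (|(m : ℝ)| - 1)) ^ ((144 : ℕ) : ℝ) :=
          Real.rpow_le_rpow_of_exponent_le hq1 (by push_cast; linarith [dimValue_bounds.2])
      _ = (|(m : ℝ)| / (|(m : ℝ)| - 1)) ^ 144 := Real.rpow_natCast _ _
      _ ≤ (37 / 36) ^ 144 := by gcongr
      _ ≤ 60 := by norm_num
  have h := abs_eval_sub_rpow_le (m := m) (t := 2 * dimNum + 142 * 10 ^ 211) (u := 10 ^ 211)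
    (p := p) (K := 60) (r := 10 ^ 217) (v := v) (by linarith)
    (by norm_num) (by unfold dimNum; norm_num) (by rw [hT]; exact hK)
    (by exact_mod_cast hr) hv
  rw [hT, eval_zero_eq, hp] at h
  have hlow : (|(m : ℝ)| / (|(m : ℝ)| - 1))⁻¹ ≤ 1 + v / m := by
    have h1 : |v / m| ≤ 1 / |(m : ℝ)| := by rw [abs_div]; gcongr
    have h2 : (|(m : ℝ)| / (|(m : ℝ)| - 1))⁻¹ = 1 - 1 / |(m : ℝ)| := by
      have : |(m : ℝ)| ≠ 0 := by linarith
      rw [inv_div]; field_simp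
    rw [h2]
    linarith [(abs_le.1 h1).1]
  have hpos : 0 < 1 + v / m := lt_of_lt_of_le (by positivity) hlow
  have hw : (1 + v / m) ^ (-(2 * dimValue + 142)) ≤ 60 := by
    rw [Real.rpow_neg hpos.le, ← Real.inv_rpow hpos.le]
    refine le_trans (Real.rpow_le_rpow (inv_nonneg.2 hpos.le) ?_ ?_) hK
    · exact inv_le_of_inv_le₀ (by positivity) hlow
    · linarith [dimValue_bounds.1]
  have hw0 := Real.rpow_pos_of_pos hpos (-(2 * dimValue + 142))
  generalize (1 + v / m) ^ (-(2 * dimValue + 142)) = w at *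
  have e : eval v p / 10 ^ 214 - κ * w =
      (eval v p - k * w) / 10 ^ 214 + (k / 10 ^ 214 - κ) * w := by field_simp; ring
  rw [e]
  refine (abs_add_le _ _).trans ?_
  rw [abs_div, abs_mul, abs_of_pos hw0, abs_of_pos (by positivity : (0 : ℝ) < 10 ^ 214)]
  have h3 : (10 : ℝ) ^ 217 / (((10 ^ 211 : ℤ) : ℝ) * |(m : ℝ)|) ≤
      10 ^ 217 / (((10 ^ 211 : ℤ) : ℝ) * 37) := by gcongr
  have h4 := h.trans (mul_le_mul_of_nonneg_left h3 (by norm_num))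
  have h5 := mul_le_mul hk hw hw0.le (by positivity)
  refine (add_le_add (div_le_div_of_nonneg_right h4 (by positivity)) h5).trans ?_
  norm_num

/-! ### The eigenvalue equation on |v| ≤ 1 -/

/-- The approximate eigenfunction. -/
noncomputable def P (v : ℝ) : ℝ := eval v coeffs / 10 ^ 208

theorem P_bounds {v : ℝ} (hv : |v| ≤ 1) : 99 / 100 ≤ P v ∧ P v ≤ 101 / 100 := by
  obtain ⟨h0, h1⟩ := norm_tail_coeffs
  have h2 : eval v coeffs = 10 ^ 208 + v * eval v coeffs.tail := by
    have : ∀ l : List ℤ, eval v l = (l.headD 0 : ℤ) + v * eval v l.tail := by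
      intro l; cases l <;> simp [eval]
    rw [this coeffs, h0, Int.cast_pow, Int.cast_ofNat]
  have h3 : |v * eval v coeffs.tail| ≤ 10 ^ 206 := by
    rw [abs_mul]
    have := mul_le_mul hv (abs_eval_le hv coeffs.tail) (abs_nonneg _) zero_le_one
    refine this.trans ?_
    rw [one_mul]
    exact_mod_cast h1
  rw [P, h2]
  have := abs_le.1 h3
  constructor
  · rw [le_div_iff₀ (by positivity)]
    refine le_trans ?_ (add_le_add_right this.1 _)
    norm_num
  · rw [div_le_iff₀ (by positivity)]
    refine le_trans (add_le_add_right this.2 _) ?_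
    norm_num

/-- Here M w is 37 + v or 55 - v. Clearing the denominator in P of a Möbius map produces (M w)^142,
which is why the weights carry the exponent -(2d + 142). The error of the weight grows by w^142 ≤
(38/37)^142, which costs two digits. -/
theorem term_error {M w b q κ y : ℝ} (hM : 0 < M) (hw : 0 < w) (hw1 : w ≤ 38 / 37)
    (hb : |b - κ * w ^ (-(2 * dimValue + 142))| ≤ 1 / 10 ^ 205)
    (hq : q = (M * w) ^ 142 * y) (hy : |y| ≤ 101 / 100) :
    |b * q / M ^ 142 - κ * w ^ (-(2 * dimValue)) * y| ≤ 1 / 10 ^ 203 := by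
  have e1 : w ^ (-(2 * dimValue + 142)) = w ^ (-(2 * dimValue)) * (w ^ 142)⁻¹ := by
    rw [neg_add, Real.rpow_add hw, Real.rpow_neg hw.le 142]
    congr 2
    exact_mod_cast Real.rpow_natCast w 142
  have e2 : b * q / M ^ 142 - κ * w ^ (-(2 * dimValue)) * y =
      (b - κ * w ^ (-(2 * dimValue + 142))) * w ^ 142 * y := by
    rw [hq, e1, mul_pow]
    generalize w ^ (-(2 * dimValue)) = z
    have : w ^ 142 ≠ 0 := by positivity
    have : M ^ 142 ≠ 0 := by positivity
    field_simp
  rw [e2, abs_mul, abs_mul, abs_of_pos (by positivity : 0 < w ^ 142)]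
  calc |b - κ * w ^ (-(2 * dimValue + 142))| * w ^ 142 * |y|
      ≤ 1 / 10 ^ 205 * (38 / 37) ^ 142 * (101 / 100) := by gcongr
    _ ≤ 1 / 10 ^ 203 := by norm_num

theorem abs_defect_le {v : ℝ} (hv : |v| ≤ 1) :
    ∃ q₁ q₂ : ℝ, q₁ = (37 + v) ^ 142 * P ((11 - 14 * v) / (37 + v)) ∧
      q₂ = (55 - v) ^ 142 * P (-(34 + 9 * v) / (55 - v)) ∧
      |P v - eval v weight₁ / 10 ^ 214 * q₁ / 37 ^ 142
        - eval v weight₂ / 10 ^ 214 * q₂ / 55 ^ 142| ≤ 1 / 10 ^ 205 := by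
  obtain ⟨acc₁, pw₁, h₁, hk₁⟩ := homThen_spec (β := ℕ) 11 (-14) 37 1 coeffs
  obtain ⟨acc₂, pw₂, h₂, hk₂⟩ := homThen_spec (β := ℕ) (-34) (-9) 55 (-1) coeffs
  obtain ⟨w₁, hw₁, hkw₁⟩ := mulThen_spec (β := ℕ) weight₁ acc₁
  obtain ⟨w₂, hw₂, hkw₂⟩ := mulThen_spec (β := ℕ) weight₂ acc₂
  have hd := defect_le
  rw [defect, forceList_eq, hk₁, hk₂, forceList_eq, forceList_eq, hkw₁, hkw₂] at hd
  have hn := (abs_eval_le hv _).trans (Nat.cast_le (α := ℝ).2 hd)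
  rw [eval_axpy, eval_axpy, eval_axpy, hw₁, hw₂] at hn
  obtain ⟨hv1, hv2⟩ := abs_le.1 hv
  have hz₁ : (37 + v) ≠ 0 := by linarith
  have hz₂ : (55 - v) ≠ 0 := by linarith
  have a₁ := (h₁ v (by push_cast; rw [one_mul]; exact hz₁)).1
  have a₂ := (h₂ v (by push_cast; rw [neg_one_mul, ← sub_eq_add_neg]; exact hz₂)).1
  rw [length_coeffs] at a₁ a₂
  simp only [Int.cast_neg, Int.cast_mul, Int.cast_pow, Int.cast_ofNat] at a₁ a₂ hn
  simp only [Int.cast_one] at a₁ a₂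
  simp only [Nat.cast_mul, Nat.cast_pow, Nat.cast_ofNat] at hn
  have c₁ : (11 + -14 * v) / (37 + 1 * v) = (11 - 14 * v) / (37 + v) := by ring_nf
  have c₂ : (-34 + -9 * v) / (55 + -1 * v) = -(34 + 9 * v) / (55 - v) := by ring_nf
  rw [c₁, one_mul, pow_succ, mul_right_comm] at a₁
  rw [c₂, neg_one_mul, ← sub_eq_add_neg, pow_succ, mul_right_comm] at a₂
  -- There are 143 coefficients but the degree is 142; the surplus linear factor cancels.
  have b₁ := mul_right_cancel₀ hz₁ a₁
  have b₂ := mul_right_cancel₀ hz₂ a₂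
  refine ⟨eval v acc₁ / 10 ^ 208, eval v acc₂ / 10 ^ 208, by rw [b₁, P, mul_div_assoc],
    by rw [b₂, P, mul_div_assoc], ?_⟩
  clear b₁ b₂ a₁ a₂ h₁ h₂ hk₁ hk₂ hd hkw₁ hkw₂ hw₁ hw₂
  rw [P]
  generalize eval v coeffs = p at *
  generalize eval v acc₁ = x₁ at *
  generalize eval v acc₂ = x₂ at *
  generalize eval v weight₁ = y₁ at *
  generalize eval v weight₂ = y₂ at *
  have e0 : (2035 : ℝ) ^ 142 = 37 ^ 142 * 55 ^ 142 := by rw [← mul_pow]; norm_num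
  rw [e0] at hn
  have f1 : (37 : ℝ) ^ 142 ≠ 0 := by positivity
  have f2 : (55 : ℝ) ^ 142 ≠ 0 := by positivity
  have e : p / 10 ^ 208 - y₁ / 10 ^ 214 * (x₁ / 10 ^ 208) / 37 ^ 142 -
      y₂ / 10 ^ 214 * (x₂ / 10 ^ 208) / 55 ^ 142 =
      (37 ^ 142 * 55 ^ 142 * 10 ^ 214 * p + (-55 ^ 142 * (y₁ * x₁) + (-37 ^ 142 * (y₂ * x₂) +
        eval v []))) / (10 ^ 422 * (37 ^ 142 * 55 ^ 142)) := by
    rw [eval, show (10 : ℝ) ^ 422 = 10 ^ 208 * 10 ^ 214 by rw [← pow_add]]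
    have f3 : (10 : ℝ) ^ 208 ≠ 0 := by positivity
    have f4 : (10 : ℝ) ^ 214 ≠ 0 := by positivity
    generalize (37 : ℝ) ^ 142 = s at *
    generalize (55 : ℝ) ^ 142 = t at *
    generalize (10 : ℝ) ^ 208 = r at *
    generalize (10 : ℝ) ^ 214 = u at *
    field_simp
    ring
  rw [e, abs_div, abs_of_pos (by positivity : (0 : ℝ) < 10 ^ 422 * (37 ^ 142 * 55 ^ 142)),
    div_le_iff₀ (by positivity)]
  have e9 : (10 : ℝ) ^ 422 = 10 ^ 205 * 10 ^ (422 - 205) := by rw [← pow_add]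
  refine hn.trans (le_of_eq ?_)
  rw [e9, mul_assoc, one_div, inv_mul_cancel_left₀ (by positivity)]

theorem approx_eigenfunction {v : ℝ} (hv : |v| ≤ 1) :
    |P v - (((37 + v) / 23) ^ (-(2 * dimValue)) * P ((11 - 14 * v) / (37 + v)) +
      ((55 - v) / 23) ^ (-(2 * dimValue)) * P (-(34 + 9 * v) / (55 - v)))| ≤ 1 / 10 ^ 202 := by
  obtain ⟨q₁, q₂, hq₁, hq₂, h⟩ := abs_defect_le hv
  obtain ⟨hv1, hv2⟩ := abs_le.1 hv
  have b₁ := weight_error (m := 37) (p := weight₁) (by norm_num) (headD_binomialAux _ _ _ _ _ _)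
    odeResidual_weight₁ kappa₁_error hv
  have b₂ := weight_error (m := -55) (p := weight₂) (by norm_num) (headD_binomialAux _ _ _ _ _ _)
    odeResidual_weight₂ kappa₂_error hv
  have y₁ := P_bounds (v := (11 - 14 * v) / (37 + v)) (by
    rw [abs_le, le_div_iff₀ (by linarith), div_le_iff₀ (by linarith)]
    constructor <;> linarith)
  have y₂ := P_bounds (v := -(34 + 9 * v) / (55 - v)) (by
    rw [abs_le, le_div_iff₀ (by linarith), div_le_iff₀ (by linarith)]
    constructor <;> linarith)
  simp only [Int.cast_neg, Int.cast_ofNat] at b₁ b₂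
  have t₁ := term_error (M := 37) (q := q₁) (by norm_num) (by linarith : 0 < 1 + v / 37) (by linarith) b₁
    (by rw [hq₁]; congr 2; ring) (abs_le.2 ⟨by linarith [y₁.1], y₁.2⟩)
  have t₂ := term_error (M := 55) (q := q₂) (by norm_num) (by linarith : 0 < 1 + v / -55) (by linarith) b₂
    (by rw [hq₂]; congr 2; ring) (abs_le.2 ⟨by linarith [y₂.1], y₂.2⟩)
  rw [← Real.mul_rpow (by norm_num) (by linarith)] at t₁ t₂
  rw [show (37 / 23 : ℝ) * (1 + v / 37) = (37 + v) / 23 by ring] at t₁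
  rw [show (55 / 23 : ℝ) * (1 + v / -55) = (55 - v) / 23 by ring] at t₂
  have h0 : (1 : ℝ) / 10 ^ 205 + 1 / 10 ^ 203 + 1 / 10 ^ 203 ≤ 1 / 10 ^ 202 := by norm_num
  rw [abs_le] at *
  constructor <;> linarith [h.1, h.2, t₁.1, t₁.2, t₂.1, t₂.2]

end EigenfunctionData

/-! ### The set `E₂` as a self-similar set -/

namespace ContFracCantor

open GenContFract Filter Topology

/-- The digit `1` or `2`. -/
def dig (b : Bool) : ℝ := if b then 2 else 1

theorem dig_mem (b : Bool) : 1 ≤ dig b ∧ dig b ≤ 2 := by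
  cases b <;> norm_num [dig]

/-- Digits ignore the integer part, so the tail of the expansion of x is that of the fractional part
of x⁻¹: the shift of digits is the Gauss map. -/
theorem s_of_fract (v : ℝ) : (GenContFract.of (Int.fract v)).s = (GenContFract.of v).s := by
  by_cases h : Int.fract v = 0
  · obtain ⟨a, rfl⟩ : ∃ a : ℤ, v = a := ⟨⌊v⌋, eq_of_sub_eq_zero h⟩
    rw [Int.fract_intCast, of_s_of_int, ← Int.cast_zero, of_s_of_int]
  · refine Stream'.Seq.ext fun n => ?_
    cases n with
    | zero =>
      have h1 := of_s_head h
      have h2 := of_s_head (v := Int.fract v) (by rwa [Int.fract_fract])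
      rw [Int.fract_fract] at h2
      exact h2.trans h1.symm
    | succ n => rw [of_s_succ, of_s_succ, Int.fract_fract]

theorem partDens_get? (v : ℝ) (n : ℕ) :
    (GenContFract.of v).partDens.get? n = ((GenContFract.of v).s.get? n).map Pair.b := by
  rw [partDens, Stream'.Seq.map_get?]

theorem fract_eq_of_h_eq_zero {x : ℝ} (h : (GenContFract.of x).h = 0) : Int.fract x = x := by
  rw [of_h_eq_floor, Int.cast_eq_zero] at h
  rw [Int.fract, h, Int.cast_zero, sub_zero]

theorem h_eq_zero_of_mem {x : ℝ} (h : x ∈ Set.Ico (0 : ℝ) 1) : (GenContFract.of x).h = 0 := by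
  rw [of_h_eq_floor, Int.cast_eq_zero]
  exact Int.floor_eq_zero_iff.2 h

theorem partDens_branch (b : Bool) {y : ℝ} (hy : y ∈ Set.Ioo (0 : ℝ) 1) :
    (GenContFract.of (1 / (dig b + y))).partDens.get? 0 = some (dig b) ∧
      ∀ n, (GenContFract.of (1 / (dig b + y))).partDens.get? (n + 1) = (GenContFract.of y).partDens.get? n := by
  have hd := dig_mem b
  set x := 1 / (dig b + y) with hx
  have hx0 : 0 < x := one_div_pos.2 (by linarith [hy.1])
  have hx1 : x < 1 := by rw [hx, div_lt_one (by linarith [hy.1])]; linarith [hy.1]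
  have hf : Int.fract x = x := Int.fract_eq_self.2 ⟨hx0.le, hx1⟩
  have hinv : x⁻¹ = dig b + y := by rw [hx, one_div, inv_inv]
  have hfl : ((⌊dig b + y⌋ : ℤ) : ℝ) = dig b := by
    cases b
    · rw [show ⌊dig false + y⌋ = 1 from Int.floor_eq_iff.2 (by
        simp only [dig]; constructor <;> norm_num <;> linarith [hy.1, hy.2])]
      simp [dig]
    · rw [show ⌊dig true + y⌋ = 2 from Int.floor_eq_iff.2 (by
        simp only [dig]; constructor <;> norm_num <;> linarith [hy.1, hy.2])]
      simp [dig]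
  constructor
  · rw [partDens_get?]
    have h := of_s_head (v := x) (by rw [hf]; exact hx0.ne')
    rw [hf, hinv, hfl] at h
    change Option.map Pair.b (GenContFract.of x).s.head = _
    rw [h]; rfl
  · intro n
    rw [partDens_get?, partDens_get?, of_s_succ, hf, hinv, ← s_of_fract]
    have : Int.fract (dig b + y) = y := by
      rw [Int.fract, hfl, add_sub_cancel_left]
    rw [this]

theorem branch_mem_Ioo (b : Bool) {y : ℝ} (hy : y ∈ Set.Ioo (0 : ℝ) 1) :
    1 / (dig b + y) ∈ Set.Ioo (0 : ℝ) 1 := by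
  have hd := dig_mem b
  exact ⟨one_div_pos.2 (by linarith [hy.1]),
    by rw [div_lt_one (by linarith [hy.1])]; linarith [hy.1]⟩

theorem exists_branch_of_mem {x : ℝ} (hx : x ∈ E₂) :
    x ∈ Set.Ioo (0 : ℝ) 1 ∧ ∃ b, ∃ y ∈ E₂, x = 1 / (dig b + y) := by
  obtain ⟨h0, hd⟩ := hx
  have hf := fract_eq_of_h_eq_zero h0
  have hx1 : x < 1 := hf ▸ Int.fract_lt_one x
  have hx0 : x ≠ 0 := by
    rintro rfl
    obtain ⟨a, -, ha⟩ := hd 0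
    rw [partDens_get?, ← Int.cast_zero, of_s_of_int] at ha
    simp at ha
  have hxpos : 0 < x := lt_of_le_of_ne (hf ▸ Int.fract_nonneg x) hx0.symm
  refine ⟨⟨hxpos, hx1⟩, ?_⟩
  have hfl : ∃ b, ((⌊x⁻¹⌋ : ℤ) : ℝ) = dig b := by
    obtain ⟨a, ha1, ha⟩ := hd 0
    have h := of_s_head (v := x) (by rwa [hf])
    rw [partDens_get?] at ha
    change Option.map Pair.b (GenContFract.of x).s.head = _ at ha
    rw [h, hf] at ha
    have ha2 : ((⌊x⁻¹⌋ : ℤ) : ℝ) = a := by simpa using ha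
    rcases ha1 with rfl | ha1
    · exact ⟨false, by simpa [dig] using ha2⟩
    · rw [Set.mem_singleton_iff] at ha1
      exact ⟨true, by simpa [dig, ha1] using ha2⟩
  obtain ⟨b, hb⟩ := hfl
  refine ⟨b, Int.fract x⁻¹, ⟨?_, fun n => ?_⟩, ?_⟩
  · exact h_eq_zero_of_mem ⟨Int.fract_nonneg _, Int.fract_lt_one _⟩
  · obtain ⟨a, ha1, ha⟩ := hd (n + 1)
    refine ⟨a, ha1, ?_⟩
    rw [partDens_get?, of_s_succ, hf, ← s_of_fract, ← partDens_get?] at ha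
    exact ha
  · rw [← hb, Int.floor_add_fract, one_div, inv_inv]

theorem branch_mem (b : Bool) {y : ℝ} (hy : y ∈ E₂) : 1 / (dig b + y) ∈ E₂ := by
  have hy1 := (exists_branch_of_mem hy).1
  obtain ⟨h0, h1⟩ := partDens_branch b hy1
  have h2 := branch_mem_Ioo b hy1
  refine ⟨h_eq_zero_of_mem ⟨h2.1.le, h2.2⟩, fun n => ?_⟩
  cases n with
  | zero => exact ⟨dig b, by cases b <;> simp [dig], h0⟩
  | succ n =>
    rw [h1]
    exact hy.2 n

theorem branch_mem_Icc (b : Bool) {y : ℝ} (hy : y ∈ Set.Icc (1 / 3 : ℝ) (3 / 4)) :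
    1 / (dig b + y) ∈ Set.Icc (1 / 3 : ℝ) (3 / 4) := by
  have hd := dig_mem b
  have h0 : 0 < dig b + y := by linarith [hy.1]
  constructor
  · rw [div_le_div_iff₀ (by norm_num) h0]; linarith [hy.2]
  · rw [div_le_div_iff₀ h0 (by norm_num)]; linarith [hy.1]

/-- One digit only confines a point to [1/3, 1]; feeding this into a second digit lowers the upper
end to 3/4. -/
theorem mem_Icc_of_mem {x : ℝ} (hx : x ∈ E₂) : x ∈ Set.Icc (1 / 3 : ℝ) (3 / 4) := by
  obtain ⟨-, b, y, hy, rfl⟩ := exists_branch_of_mem hx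
  obtain ⟨-, b', z, hz, rfl⟩ := exists_branch_of_mem hy
  obtain ⟨⟨hz0, hz1⟩, -⟩ := exists_branch_of_mem hz
  have hd := dig_mem b
  have hd' := dig_mem b'
  have h1 : 1 / 3 ≤ 1 / (dig b' + z) := by
    rw [div_le_div_iff₀ (by norm_num) (by linarith)]; linarith
  have h2 : 1 / (dig b' + z) ≤ 1 := by
    rw [div_le_one (by linarith)]; linarith
  set y := 1 / (dig b' + z)
  constructor
  · rw [div_le_div_iff₀ (by norm_num) (by linarith)]; linarith
  · rw [div_le_div_iff₀ (by linarith) (by norm_num)]; linarith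

theorem abs_branch_sub (b : Bool) {y z : ℝ} (hy : 0 < dig b + y) (hz : 0 < dig b + z) :
    |1 / (dig b + y) - 1 / (dig b + z)| = |y - z| / ((dig b + y) * (dig b + z)) := by
  rw [div_sub_div _ _ hy.ne' hz.ne', abs_div, abs_of_pos (mul_pos hy hz), one_mul, mul_one,
    add_sub_add_left_eq_sub, abs_sub_comm]

/-- Iterated branches along a sequence of digits. -/
noncomputable def approximant : ℕ → (ℕ → Bool) → ℝ
  | 0, _ => 1 / 2
  | n + 1, ω => 1 / (dig (ω 0) + approximant n fun k => ω (k + 1))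

theorem approximant_mem (n : ℕ) (ω : ℕ → Bool) :
    approximant n ω ∈ Set.Icc (1 / 3 : ℝ) (3 / 4) := by
  induction n generalizing ω with
  | zero => constructor <;> norm_num [approximant]
  | succ n ih => exact branch_mem_Icc _ (ih _)

/-- On [1/3, 3/4] both branches contract by (3/4)² = 9/16, the denominators being at least 4/3. -/
theorem dist_approximant_le (n : ℕ) (ω : ℕ → Bool) :
    dist (approximant n ω) (approximant (n + 1) ω) ≤ 1 * (9 / 16) ^ n := by
  induction n generalizing ω with
  | zero =>
    have h0 := approximant_mem 0 ω
    have h1 := approximant_mem 1 ω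
    rw [Real.dist_eq, abs_le]
    constructor <;> linarith [h0.1, h0.2, h1.1, h1.2]
  | succ n ih =>
    have h0 := approximant_mem n fun k => ω (k + 1)
    have h1 := approximant_mem (n + 1) fun k => ω (k + 1)
    have hd := dig_mem (ω 0)
    rw [Real.dist_eq, approximant, approximant,
      abs_branch_sub _ (by linarith [h0.1]) (by linarith [h1.1])]
    have h := ih fun k => ω (k + 1)
    rw [Real.dist_eq] at h
    rw [div_le_iff₀ (mul_pos (by linarith [h0.1]) (by linarith [h1.1])), pow_succ]
    have h2 : (16 / 9 : ℝ) ≤ (dig (ω 0) + approximant n fun k => ω (k + 1)) *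
        (dig (ω 0) + approximant (n + 1) fun k => ω (k + 1)) := by
      calc (16 / 9 : ℝ) = 4 / 3 * (4 / 3) := by norm_num
        _ ≤ _ := mul_le_mul (by linarith [h0.1]) (by linarith [h1.1]) (by norm_num)
          (by linarith [h0.1])
    calc _ ≤ 1 * (9 / 16 : ℝ) ^ n := h
      _ = 1 * ((9 / 16 : ℝ) ^ n * (9 / 16)) * (16 / 9) := by ring
      _ ≤ _ := by gcongr

theorem exists_point : ∃ π : (ℕ → Bool) → ℝ, (∀ ω, π ω ∈ E₂) ∧
    ∀ ω, π ω = 1 / (dig (ω 0) + π fun k => ω (k + 1)) := by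
  have hlim : ∀ ω, ∃ x, Tendsto (fun n => approximant n ω) atTop (𝓝 x) := fun ω =>
    cauchySeq_tendsto_of_complete (cauchySeq_of_le_geometric (9 / 16) 1 (by norm_num)
      fun n => dist_approximant_le n ω)
  choose π hπ using hlim
  have hmem : ∀ ω, π ω ∈ Set.Icc (1 / 3 : ℝ) (3 / 4) := fun ω =>
    isClosed_Icc.mem_of_tendsto (hπ ω) (Eventually.of_forall fun n => approximant_mem n ω)
  have hrec : ∀ ω, π ω = 1 / (dig (ω 0) + π fun k => ω (k + 1)) := fun ω => by
    have h1 := (tendsto_add_atTop_iff_nat 1).2 (hπ ω)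
    refine tendsto_nhds_unique h1 ?_
    have hd := dig_mem (ω 0)
    exact tendsto_const_nhds.div ((hπ fun k => ω (k + 1)).const_add _)
      (by linarith [(hmem fun k => ω (k + 1)).1])
  have hIoo : ∀ ω, π ω ∈ Set.Ioo (0 : ℝ) 1 := fun ω =>
    ⟨by linarith [(hmem ω).1], by linarith [(hmem ω).2]⟩
  have hdig : ∀ (n : ℕ) (ω : ℕ → Bool), (GenContFract.of (π ω)).partDens.get? n = some (dig (ω n)) := by
    intro n
    induction n with
    | zero => intro ω; rw [hrec]; exact (partDens_branch _ (hIoo _)).1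
    | succ n ih => intro ω; rw [hrec, (partDens_branch _ (hIoo _)).2, ih]
  refine ⟨π, fun ω => ⟨h_eq_zero_of_mem ⟨(hIoo ω).1.le, (hIoo ω).2⟩, fun n =>
    ⟨dig (ω n), ?_, hdig n ω⟩⟩, hrec⟩
  cases ω n <;> simp [dig]

end ContFracCantor

/-! ### Cylinders, and dimension bounds from sub- and supersolutions of the transfer operator -/

namespace ContFracCantor

open Filter Topology MeasureTheory Measure
open scoped ENNReal NNReal

/-- The inverse branch along a word (newest digit first), followed by `y ↦ 1 / (2 + y)`. -/
noncomputable def wordMap : List Bool → ℝ → ℝ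
  -- The fixed leading digit 2 starts the ratio of denominators at 1/2. Without it the ratio would
  -- start at 0, outside the interval where g is controlled.
  | [], y => 1 / (2 + y)
  | b :: a, y => wordMap a (1 / (dig b + y))

/-- The denominators of the last two convergents along a word. -/
noncomputable def den : List Bool → ℝ × ℝ
  | [] => (2, 1)
  | b :: a => (dig b * (den a).1 + (den a).2, (den a).1)

/-- The ratio of the denominators evolves by the branches r ↦ 1/(b+r), and so never leaves [1/3,
3/4]. -/
theorem den_props (a : List Bool) :
    0 < (den a).1 ∧ (den a).2 / (den a).1 ∈ Set.Icc (1 / 3 : ℝ) (3 / 4) ∧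
      (4 / 3) ^ a.length ≤ (den a).1 := by
  induction a with
  | nil => refine ⟨?_, ⟨?_, ?_⟩, ?_⟩ <;> norm_num [den]
  | cons b a ih =>
    obtain ⟨h0, h1, h2⟩ := ih
    have hd := dig_mem b
    have e : (den (b :: a)).1 = (den a).1 * (dig b + (den a).2 / (den a).1) := by
      rw [den]; field_simp
    have h3 : 4 / 3 ≤ dig b + (den a).2 / (den a).1 := by linarith [h1.1]
    refine ⟨?_, ?_, ?_⟩
    · rw [e]; exact mul_pos h0 (by linarith)
    · have := branch_mem_Icc b h1
      rwa [e, den, div_mul_eq_div_div, div_self h0.ne']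
    · rw [e, List.length_cons, pow_succ]
      exact mul_le_mul h2 h3 (by norm_num) h0.le

theorem den_pos (a : List Bool) : 0 < (den a).1 := (den_props a).1

theorem den_snd_mem (a : List Bool) : 0 < (den a).2 ∧ (den a).2 ≤ (den a).1 := by
  obtain ⟨h0, h1, -⟩ := den_props a
  have h2 := h1.1
  have h3 := h1.2
  rw [le_div_iff₀ h0] at h2
  rw [div_le_iff₀ h0] at h3
  constructor <;> linarith

/-- The map is a Möbius transformation of determinant ±1 whose denominator is q + q' y. -/
theorem abs_wordMap_sub (a : List Bool) {y z : ℝ} (hy : 0 ≤ y) (hz : 0 ≤ z) :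
    |wordMap a y - wordMap a z| =
      |y - z| / (((den a).1 + (den a).2 * y) * ((den a).1 + (den a).2 * z)) := by
  induction a generalizing y z with
  | nil =>
    have := abs_branch_sub true (y := y) (z := z) (by norm_num [dig]; linarith)
      (by norm_num [dig]; linarith)
    simpa [wordMap, den, dig] using this
  | cons b a ih =>
    have hd := dig_mem b
    have h0 := den_pos a
    have h1 := (den_snd_mem a).1
    have hy' : 0 < dig b + y := by linarith
    have hz' : 0 < dig b + z := by linarith
    rw [wordMap, wordMap, ih (by positivity) (by positivity), abs_branch_sub b hy' hz', den]
    have e : ∀ w : ℝ, 0 < dig b + w → (den a).1 + (den a).2 * (1 / (dig b + w)) =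
        (dig b * (den a).1 + (den a).2 + (den a).1 * w) / (dig b + w) := by
      intro w hw; field_simp; ring
    rw [e y hy', e z hz']
    have p1 : 0 < dig b * (den a).1 + (den a).2 + (den a).1 * y := by
      have : 0 < dig b := by linarith
      positivity
    have p2 : 0 < dig b * (den a).1 + (den a).2 + (den a).1 * z := by
      have : 0 < dig b := by linarith
      positivity
    field_simp

/-- The set of the points of `E₂` whose expansion starts with the digit `2` and a given word. -/
def cylinder (a : List Bool) : Set ℝ := wordMap a '' E₂

theorem cylinder_cons_subset (b : Bool) (a : List Bool) : cylinder (b :: a) ⊆ cylinder a := by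
  rintro _ ⟨y, hy, rfl⟩
  exact ⟨_, branch_mem b hy, rfl⟩

theorem exists_mem_cylinder_cons {a : List Bool} {x : ℝ} (hx : x ∈ cylinder a) :
    ∃ b, x ∈ cylinder (b :: a) := by
  obtain ⟨y, hy, rfl⟩ := hx
  obtain ⟨-, b, z, hz, rfl⟩ := exists_branch_of_mem hy
  exact ⟨b, z, hz, rfl⟩

/-- The images under the two branches lie above 4/7 and below 3/7, a gap of 1/7, and each
denominator is at most 2q; 28 = 7 · 2 · 2. -/
theorem abs_sub_ge_of_mem_cylinder {a : List Bool} {x₁ x₂ : ℝ} (h₁ : x₁ ∈ cylinder (false :: a))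
    (h₂ : x₂ ∈ cylinder (true :: a)) : 1 / (28 * (den a).1 ^ 2) ≤ |x₁ - x₂| := by
  obtain ⟨y, hy, rfl⟩ := h₁
  obtain ⟨z, hz, rfl⟩ := h₂
  have hy' := branch_mem_Icc false (mem_Icc_of_mem hy)
  have hz' := branch_mem_Icc true (mem_Icc_of_mem hz)
  have hy1 := mem_Icc_of_mem hy
  have hz1 := mem_Icc_of_mem hz
  have k1 : 4 / 7 ≤ 1 / (dig false + y) := by
    rw [div_le_div_iff₀ (by norm_num) (by norm_num [dig]; linarith [hy1.1])]
    norm_num [dig]; linarith [hy1.2]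
  have k2 : 1 / (dig true + z) ≤ 3 / 7 := by
    rw [div_le_div_iff₀ (by norm_num [dig]; linarith [hz1.1]) (by norm_num)]
    norm_num [dig]; linarith [hz1.1]
  have h0 := den_pos a
  have h1 := den_snd_mem a
  rw [wordMap, wordMap, abs_wordMap_sub a (by linarith [hy'.1]) (by linarith [hz'.1])]
  have hb : ∀ w ∈ Set.Icc (1 / 3 : ℝ) (3 / 4),
      0 < (den a).1 + (den a).2 * w ∧ (den a).1 + (den a).2 * w ≤ 2 * (den a).1 := by
    intro w hw
    have : 0 ≤ (den a).2 * w := mul_nonneg h1.1.le (by linarith [hw.1])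
    have : (den a).2 * w ≤ (den a).1 * 1 := mul_le_mul h1.2 (by linarith [hw.2])
      (by linarith [hw.1]) h0.le
    constructor <;> linarith
  obtain ⟨b1, b2⟩ := hb _ hy'
  obtain ⟨c1, c2⟩ := hb _ hz'
  rw [div_le_div_iff₀ (by positivity) (mul_pos b1 c1)]
  have h3 : 1 / 7 ≤ |1 / (dig false + y) - 1 / (dig true + z)| := by
    refine le_trans ?_ (le_abs_self _); linarith
  calc 1 * (((den a).1 + (den a).2 * (1 / (dig false + y))) *
        ((den a).1 + (den a).2 * (1 / (dig true + z))))
      ≤ 1 * ((2 * (den a).1) * (2 * (den a).1)) := by gcongr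
    _ = 1 / 7 * (28 * (den a).1 ^ 2) := by ring
    _ ≤ _ := by gcongr

theorem eq_of_mem_cylinder {a b : List Bool} (hab : a.length = b.length) {x : ℝ}
    (ha : x ∈ cylinder a) (hb : x ∈ cylinder b) : a = b := by
  induction a generalizing b with
  | nil => exact (List.length_eq_zero_iff.1 hab.symm).symm
  | cons i a ih =>
    cases b with
    | nil => simp at hab
    | cons j b =>
      have h := ih (by simpa using hab) (cylinder_cons_subset _ _ ha)
        (cylinder_cons_subset _ _ hb)
      subst h
      have hpos : 0 < 1 / (28 * (den a).1 ^ 2) := by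
        have := den_pos a
        positivity
      cases i <;> cases j
      · rfl
      · have := abs_sub_ge_of_mem_cylinder ha hb
        rw [sub_self, abs_zero] at this
        linarith
      · have := abs_sub_ge_of_mem_cylinder hb ha
        rw [sub_self, abs_zero] at this
        linarith
      · rfl

theorem ediam_cylinder_le (a : List Bool) :
    Metric.ediam (cylinder a) ≤ ENNReal.ofReal (1 / (den a).1 ^ 2) := by
  refine Metric.ediam_le ?_
  rintro _ ⟨y, hy, rfl⟩ _ ⟨z, hz, rfl⟩
  have hy1 := mem_Icc_of_mem hy
  have hz1 := mem_Icc_of_mem hz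
  have h0 := den_pos a
  have h1 := den_snd_mem a
  rw [edist_dist, Real.dist_eq,
    abs_wordMap_sub a (by linarith [hy1.1]) (by linarith [hz1.1])]
  refine ENNReal.ofReal_le_ofReal ?_
  have h2 : |y - z| ≤ 1 := by
    rw [abs_le]; constructor <;> linarith [hy1.1, hy1.2, hz1.1, hz1.2]
  have h3 : ∀ w ∈ Set.Icc (1 / 3 : ℝ) (3 / 4), (den a).1 ≤ (den a).1 + (den a).2 * w := by
    intro w hw
    have : 0 ≤ (den a).2 * w := mul_nonneg h1.1.le (by linarith [hw.1])
    linarith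
  rw [sq]
  have h4 := h3 _ hy1
  have h5 := h3 _ hz1
  gcongr
  exact h0.le.trans h4

/-! ### Weights of words and the transfer operator -/

section Weights

variable (s : ℝ) (g : ℝ → ℝ)

/-- The value at `t` of the transfer operator applied to `g`. -/
noncomputable def transfer (t : ℝ) : ℝ :=
  (1 + t) ^ (-(2 * s)) * g (1 / (1 + t)) + (2 + t) ^ (-(2 * s)) * g (1 / (2 + t))

/-- The mass that `g` assigns to a cylinder. -/
noncomputable def weight (a : List Bool) : ℝ :=
  (den a).1 ^ (-(2 * s)) * g ((den a).2 / (den a).1)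

theorem weight_cons_add (a : List Bool) :
    weight s g (false :: a) + weight s g (true :: a) =
      (den a).1 ^ (-(2 * s)) * transfer s g ((den a).2 / (den a).1) := by
  obtain ⟨h0, h1, -⟩ := den_props a
  have e : ∀ b, weight s g (b :: a) = (den a).1 ^ (-(2 * s)) *
      ((dig b + (den a).2 / (den a).1) ^ (-(2 * s)) *
        g (1 / (dig b + (den a).2 / (den a).1))) := by
    intro b
    have hd := dig_mem b
    have e : (den (b :: a)).1 = (den a).1 * (dig b + (den a).2 / (den a).1) := by
      rw [den]; field_simp
    have e2 : (den (b :: a)).2 = (den a).1 := rfl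
    rw [weight, e, e2, Real.mul_rpow h0.le (by linarith [h1.1]), mul_assoc, div_mul_eq_div_div,
      div_self h0.ne']
  rw [e, e, transfer, ← mul_add]
  simp [dig]

end Weights

variable {s : ℝ} {g : ℝ → ℝ} {c C : ℝ}

theorem rpow_den_sq (a : List Bool) : (1 / (den a).1 ^ 2) ^ s = (den a).1 ^ (-(2 * s)) := by
  have h0 := den_pos a
  rw [one_div, ← Real.rpow_natCast, ← Real.rpow_neg h0.le, ← Real.rpow_mul h0.le]
  congr 1; push_cast; ring

/-! ### Upper bound for the dimension -/

theorem sum_weight_le (h : ∀ t ∈ Set.Icc (1 / 3 : ℝ) (3 / 4), transfer s g t ≤ g t) (n : ℕ) :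
    ∑ v : Fin n → Bool, weight s g (List.ofFn v) ≤ weight s g [] := by
  induction n with
  | zero => simp
  | succ n ih =>
    refine le_trans ?_ ih
    -- The head of the list is the newest digit, so splitting it off groups siblings.
    rw [← (Fin.consEquiv fun _ : Fin (n + 1) => Bool).sum_comp, Fintype.sum_prod_type_right]
    refine Finset.sum_le_sum fun v _ => ?_
    have e : ∀ b, List.ofFn (Fin.consEquiv (fun _ : Fin (n + 1) => Bool) (b, v)) =
        b :: List.ofFn v := fun b => List.ofFn_cons b v
    rw [Fintype.sum_bool, e, e, add_comm, weight_cons_add]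
    have h0 := den_pos (List.ofFn v)
    exact mul_le_mul_of_nonneg_left (h _ (den_props _).2.1) (by positivity)

theorem cylinder_nil_subset_iUnion (n : ℕ) :
    cylinder [] ⊆ ⋃ v : Fin n → Bool, cylinder (List.ofFn v) := by
  induction n with
  | zero => exact fun x hx => Set.mem_iUnion.2 ⟨Fin.elim0, by simpa using hx⟩
  | succ n ih =>
    intro x hx
    obtain ⟨v, hv⟩ := Set.mem_iUnion.1 (ih hx)
    obtain ⟨b, hb⟩ := exists_mem_cylinder_cons hv
    exact Set.mem_iUnion.2 ⟨Fin.cons b v, by rwa [List.ofFn_cons]⟩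

theorem hausdorffMeasure_cylinder_nil_lt_top (hs : 0 ≤ s) (hc : 0 < c)
    (hg : ∀ t ∈ Set.Icc (1 / 3 : ℝ) (3 / 4), c ≤ g t)
    (h : ∀ t ∈ Set.Icc (1 / 3 : ℝ) (3 / 4), transfer s g t ≤ g t) :
    μH[s] (cylinder []) ≠ ∞ := by
  have hr : Tendsto (fun n : ℕ => ENNReal.ofReal ((9 / 16 : ℝ) ^ n)) atTop (𝓝 0) := by
    rw [← ENNReal.ofReal_zero]
    exact ENNReal.tendsto_ofReal
      (tendsto_pow_atTop_nhds_zero_of_lt_one (by norm_num) (by norm_num))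
  have hd : ∀ n (v : Fin n → Bool),
      Metric.ediam (cylinder (List.ofFn v)) ≤ ENNReal.ofReal ((9 / 16 : ℝ) ^ n) := by
    intro n v
    refine (ediam_cylinder_le _).trans (ENNReal.ofReal_le_ofReal ?_)
    have h1 := (den_props (List.ofFn v)).2.2
    rw [List.length_ofFn] at h1
    rw [one_div]
    calc ((den (List.ofFn v)).1 ^ 2)⁻¹ ≤ (((4 / 3 : ℝ) ^ n) ^ 2)⁻¹ := by gcongr
      _ = (9 / 16) ^ n := by rw [← pow_mul, mul_comm, pow_mul, ← inv_pow]; norm_num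
  have key := hausdorffMeasure_le_liminf_sum s (cylinder []) _ hr
    (fun n (v : Fin n → Bool) => cylinder (List.ofFn v)) (Eventually.of_forall hd)
    (Eventually.of_forall cylinder_nil_subset_iUnion)
  refine ne_top_of_le_ne_top (b := ENNReal.ofReal (weight s g [] / c)) ENNReal.ofReal_ne_top
    (key.trans ?_)
  refine liminf_le_of_le (by isBoundedDefault) fun B hB => ?_
  obtain ⟨n, hn⟩ := hB.exists
  refine hn.trans ?_
  calc ∑ v : Fin n → Bool, Metric.ediam (cylinder (List.ofFn v)) ^ s
      ≤ ∑ v : Fin n → Bool, ENNReal.ofReal (weight s g (List.ofFn v) / c) := by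
        refine Finset.sum_le_sum fun v _ => ?_
        have h0 := den_pos (List.ofFn v)
        refine (ENNReal.rpow_le_rpow (ediam_cylinder_le _) hs).trans ?_
        rw [ENNReal.ofReal_rpow_of_nonneg (by positivity) hs, rpow_den_sq]
        refine ENNReal.ofReal_le_ofReal ?_
        rw [le_div_iff₀ hc]
        exact mul_le_mul_of_nonneg_left (hg _ (den_props _).2.1) (by positivity)
    _ = ENNReal.ofReal (∑ v : Fin n → Bool, weight s g (List.ofFn v) / c) := by
        refine (ENNReal.ofReal_sum_of_nonneg fun v _ => ?_).symm
        have h0 := den_pos (List.ofFn v)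
        have := hg _ (den_props (List.ofFn v)).2.1
        exact div_nonneg (mul_nonneg (by positivity) (by linarith)) hc.le
    _ ≤ ENNReal.ofReal (weight s g [] / c) := by
        refine ENNReal.ofReal_le_ofReal ?_
        rw [← Finset.sum_div]
        exact div_le_div_of_nonneg_right (sum_weight_le h n) hc.le

theorem dimH_le_of_transfer_le (hs : 0 ≤ s) (hc : 0 < c)
    (hg : ∀ t ∈ Set.Icc (1 / 3 : ℝ) (3 / 4), c ≤ g t)
    (h : ∀ t ∈ Set.Icc (1 / 3 : ℝ) (3 / 4), transfer s g t ≤ g t) :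
    dimH E₂ ≤ ENNReal.ofReal s := by
  have h1 : dimH (cylinder []) ≤ ENNReal.ofReal s := by
    refine dimH_le_of_hausdorffMeasure_ne_top (d := s.toNNReal) ?_
    rw [Real.coe_toNNReal s hs]
    exact hausdorffMeasure_cylinder_nil_lt_top hs hc hg h
  -- Removing the leading digit 2 maps the root cylinder onto `E₂`; since its points are at least
  -- 1/3, this map is 9-Lipschitz.
  have h2 : LipschitzOnWith 9 (fun x : ℝ => 1 / x - 2) (cylinder []) := by
    have hge : ∀ x ∈ cylinder [], 1 / 3 ≤ x := by
      rintro _ ⟨y, hy, rfl⟩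
      have hy1 := mem_Icc_of_mem hy
      rw [wordMap, div_le_div_iff₀ (by norm_num) (by linarith [hy1.1])]
      linarith [hy1.2]
    refine LipschitzOnWith.of_dist_le_mul fun x hx y hy => ?_
    have hx1 := hge x hx
    have hy1 := hge y hy
    have hx0 : 0 < x := by linarith
    have hy0 : 0 < y := by linarith
    rw [Real.dist_eq, Real.dist_eq, sub_sub_sub_cancel_right, div_sub_div _ _ hx0.ne' hy0.ne',
      one_mul, mul_one, abs_div, abs_of_pos (mul_pos hx0 hy0), abs_sub_comm,
      div_le_iff₀ (mul_pos hx0 hy0)]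
    have h3 : (1 / 9 : ℝ) ≤ x * y := by
      calc (1 / 9 : ℝ) = 1 / 3 * (1 / 3) := by norm_num
        _ ≤ x * y := mul_le_mul hx1 hy1 (by norm_num) hx0.le
    have : 0 ≤ |x - y| := abs_nonneg _
    push_cast
    nlinarith
  refine le_trans (le_of_eq ?_) (h2.dimH_image_le.trans h1)
  congr 1
  rw [cylinder, Set.image_image]
  refine (Set.image_congr fun y hy => ?_).trans (Set.image_id _) |>.symm
  have hy1 := mem_Icc_of_mem hy
  rw [wordMap, one_div_one_div, add_sub_cancel_left, id]

/-! ### Lower bound for the dimension -/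

/-- The first `k` digits of a sequence, the last of them first. -/
def initial (ω : ℕ → Bool) : ℕ → List Bool
  | 0 => []
  | k + 1 => ω k :: initial ω k

theorem length_initial (ω : ℕ → Bool) (k : ℕ) : (initial ω k).length = k := by
  induction k with
  | zero => rfl
  | succ k ih => rw [initial, List.length_cons, ih]

/-- If masses attached to words have a total less than that of a superadditive function at the
root, then some infinite branch avoids all words with at least their share of mass. -/
theorem exists_light_branch {m : List Bool → ℝ≥0∞}
    (hm : ∀ a, m a ≤ m (false :: a) + m (true :: a)) (A : ℕ → List Bool) (w : ℕ → ℝ≥0∞)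
    (hw : ∑' n, w n < m []) :
    ∃ ω : ℕ → Bool, ∀ k n, A n = initial ω k → w n < m (A n) := by
  classical
  -- `S a` is the share claimed by the words extending `a`. Going down the tree it is split, while
  -- `m` is superadditive, so `S < m` survives in at least one child.
  let S : List Bool → ℝ≥0∞ := fun a => ∑' n, if a <:+ A n then w n else 0
  have hS : ∀ a, S (false :: a) + S (true :: a) ≤ S a := by
    intro a
    simp only [S]
    rw [← ENNReal.tsum_add]
    refine ENNReal.tsum_le_tsum fun n => ?_
    by_cases h1 : (false :: a) <:+ A n
    · have h2 : ¬ (true :: a) <:+ A n := by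
        intro h2
        have := List.suffix_of_suffix_length_le h1 h2 (by simp)
        have := this.eq_of_length (by simp)
        simp at this
      rw [if_pos h1, if_neg h2, if_pos ((List.suffix_cons _ _).trans h1), add_zero]
    · by_cases h2 : (true :: a) <:+ A n
      · rw [if_neg h1, if_pos h2, if_pos ((List.suffix_cons _ _).trans h2), zero_add]
      · rw [if_neg h1, if_neg h2, add_zero]
        exact zero_le
  have hstep : ∀ a : {a // S a < m a}, ∃ b, S (b :: a.1) < m (b :: a.1) := by
    rintro ⟨a, ha⟩
    by_contra! hcon
    have := ((hS a).trans_lt ha).trans_le (hm a)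
    exact absurd (add_le_add (hcon false) (hcon true)) (not_le.2 this)
  choose β hβ using hstep
  have h0 : S [] < m [] := by simpa [S] using hw
  let W : ℕ → {a // S a < m a} := fun k =>
    Nat.rec ⟨[], h0⟩ (fun _ a => ⟨β a :: a.1, hβ a⟩) k
  let ω : ℕ → Bool := fun k => β (W k)
  have hW : ∀ k, initial ω k = (W k).1 := by
    intro k
    induction k with
    | zero => rfl
    | succ k ih => rw [initial, ih]
  refine ⟨ω, fun k n hn => ?_⟩
  have h1 := (W k).2
  rw [← hW, ← hn] at h1
  refine lt_of_le_of_lt ?_ h1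
  have := ENNReal.le_tsum (f := fun j => if A n <:+ A j then w j else 0) n
  simpa using this

/-- Take the longest word whose cylinder contains the set. Both children are then met, so the gap
bounds q^(-2) by 28 times the diameter. If there is no longest word, long words have weight below
`ε`. -/
theorem exists_cylinder_cover (hs : 0 < s) (hC : 0 ≤ C)
    (hg : ∀ t ∈ Set.Icc (1 / 3 : ℝ) (3 / 4), g t ≤ C) (U : Set ℝ) {ε : ℝ≥0∞} (hε : ε ≠ 0) :
    ∃ a, U ∩ cylinder [] ⊆ cylinder a ∧
      ENNReal.ofReal (weight s g a) ≤ ENNReal.ofReal (C * 28 ^ s) * Metric.ediam U ^ s + ε := by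
  have hweight : ∀ a, weight s g a ≤ C * (1 / (den a).1 ^ 2) ^ s := by
    intro a
    have h0 := den_pos a
    rw [rpow_den_sq, mul_comm]
    exact mul_le_mul_of_nonneg_left (hg _ (den_props a).2.1) (by positivity)
  by_cases hall : ∀ n : ℕ, ∃ a : List Bool, a.length = n ∧ U ∩ cylinder [] ⊆ cylinder a
  · have hr : Tendsto (fun n : ℕ => ENNReal.ofReal (C * ((9 / 16 : ℝ) ^ s) ^ n)) atTop (𝓝 0) := by
      rw [← ENNReal.ofReal_zero, ← mul_zero C]
      exact ENNReal.tendsto_ofReal ((tendsto_pow_atTop_nhds_zero_of_lt_one (by positivity)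
        (Real.rpow_lt_one (by norm_num) (by norm_num) hs)).const_mul C)
    obtain ⟨n, hn⟩ := ((tendsto_order.1 hr).2 ε (pos_iff_ne_zero.2 hε)).exists
    obtain ⟨a, ha, hU⟩ := hall n
    refine ⟨a, hU, le_trans ?_ (hn.le.trans le_add_self)⟩
    refine ENNReal.ofReal_le_ofReal ((hweight a).trans ?_)
    have h1 := (den_props a).2.2
    rw [ha] at h1
    have h0 := den_pos a
    have h2 : 1 / (den a).1 ^ 2 ≤ (9 / 16) ^ n := by
      rw [one_div]
      calc ((den a).1 ^ 2)⁻¹ ≤ (((4 / 3 : ℝ) ^ n) ^ 2)⁻¹ := by gcongr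
        _ = (9 / 16) ^ n := by rw [← pow_mul, mul_comm, pow_mul, ← inv_pow]; norm_num
    have h3 : ((9 / 16 : ℝ) ^ s) ^ n = ((9 / 16) ^ n) ^ s := by
      rw [← Real.rpow_natCast, ← Real.rpow_natCast, ← Real.rpow_mul (by norm_num),
        ← Real.rpow_mul (by norm_num), mul_comm]
    rw [h3]
    gcongr
  · have hex : ∃ n, (∃ a : List Bool, a.length = n ∧ U ∩ cylinder [] ⊆ cylinder a) ∧
        ¬ ∃ a : List Bool, a.length = n + 1 ∧ U ∩ cylinder [] ⊆ cylinder a := by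
      by_contra! hcon
      refine hall fun n => ?_
      induction n with
      | zero => exact ⟨[], rfl, Set.inter_subset_right⟩
      | succ n ih => exact hcon n ih
    obtain ⟨n, ⟨a, ha, hU⟩, hno⟩ := hex
    refine ⟨a, hU, le_trans ?_ le_self_add⟩
    have hsep : ∀ b, ∃ x ∈ U ∩ cylinder [], x ∉ cylinder (b :: a) := by
      intro b
      by_contra! hcon
      exact hno ⟨b :: a, by rw [List.length_cons, ha], hcon⟩
    obtain ⟨x₁, hx₁, hx₁'⟩ := hsep true
    obtain ⟨x₂, hx₂, hx₂'⟩ := hsep false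
    have h₁ : x₁ ∈ cylinder (false :: a) := by
      obtain ⟨b, hb⟩ := exists_mem_cylinder_cons (hU hx₁)
      cases b
      · exact hb
      · exact absurd hb hx₁'
    have h₂ : x₂ ∈ cylinder (true :: a) := by
      obtain ⟨b, hb⟩ := exists_mem_cylinder_cons (hU hx₂)
      cases b
      · exact absurd hb hx₂'
      · exact hb
    have hge := abs_sub_ge_of_mem_cylinder h₁ h₂
    have h0 := den_pos a
    have h1 : 1 / (den a).1 ^ 2 ≤ 28 * |x₁ - x₂| := by
      have e : 1 / (28 * (den a).1 ^ 2) = 1 / (den a).1 ^ 2 / 28 := by field_simp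
      rw [e, div_le_iff₀ (by norm_num)] at hge
      linarith
    have h2 : weight s g a ≤ C * 28 ^ s * |x₁ - x₂| ^ s := by
      refine (hweight a).trans ?_
      rw [mul_assoc, ← Real.mul_rpow (by norm_num) (abs_nonneg _)]
      gcongr
    refine (ENNReal.ofReal_le_ofReal h2).trans ?_
    rw [ENNReal.ofReal_mul (by positivity)]
    gcongr
    rw [← ENNReal.ofReal_rpow_of_nonneg (abs_nonneg _) hs.le]
    refine ENNReal.rpow_le_rpow ?_ hs.le
    rw [← Real.dist_eq, ← edist_dist]
    exact Metric.edist_le_ediam_of_mem hx₁.1 hx₂.1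

theorem wordMap_initial {π : (ℕ → Bool) → ℝ}
    (hπ : ∀ ω, π ω = 1 / (dig (ω 0) + π fun k => ω (k + 1))) (ω : ℕ → Bool) (k : ℕ) :
    wordMap [] (π ω) = wordMap (initial ω k) (π fun j => ω (j + k)) := by
  induction k with
  | zero => rfl
  | succ k ih =>
    rw [ih, hπ, initial, wordMap, Nat.zero_add]
    congr 4
    funext j
    rw [add_right_comm, add_assoc]

/-- A mass distribution argument without a measure. If the cover were too cheap,
`exists_light_branch` would give digits avoiding every covering cylinder; the point with these
digits lies in some `U n`, hence in the cylinder of `A n`, a contradiction. -/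
theorem le_tsum_of_cover (hs : 0 < s) (hC : 0 ≤ C) (hg0 : ∀ t ∈ Set.Icc (1 / 3 : ℝ) (3 / 4), 0 ≤ g t)
    (hg : ∀ t ∈ Set.Icc (1 / 3 : ℝ) (3 / 4), g t ≤ C)
    (h : ∀ t ∈ Set.Icc (1 / 3 : ℝ) (3 / 4), g t ≤ transfer s g t) (U : ℕ → Set ℝ)
    (hU : cylinder [] ⊆ ⋃ n, U n) :
    ENNReal.ofReal (weight s g []) ≤
      ENNReal.ofReal (C * 28 ^ s) * ∑' n, ⨆ _ : (U n).Nonempty, Metric.ediam (U n) ^ s := by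
  classical
  refine ENNReal.le_of_forall_pos_le_add fun ε hε _ => ?_
  obtain ⟨ε', hε', hsum⟩ := ENNReal.exists_pos_sum_of_countable' (ENNReal.coe_pos.2 hε).ne' ℕ
  choose A hA hAw using fun n => exists_cylinder_cover hs hC hg (U n) (hε' n).ne'
  by_contra! hcon
  let w : ℕ → ℝ≥0∞ := fun n =>
    if (U n).Nonempty then ENNReal.ofReal (weight s g (A n)) else 0
  have hw : ∑' n, w n < ENNReal.ofReal (weight s g []) := by
    refine lt_of_le_of_lt ?_ hcon
    refine le_trans ?_ (add_le_add_right hsum.le _)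
    rw [← ENNReal.tsum_mul_left, ← ENNReal.tsum_add]
    refine ENNReal.tsum_le_tsum fun n => ?_
    by_cases hn : (U n).Nonempty
    · simpa [w, hn] using hAw n
    · simp [w, hn]
  have hnn : ∀ a, 0 ≤ weight s g a := fun a => by
    have h0 := den_pos a
    exact mul_nonneg (by positivity) (hg0 _ (den_props a).2.1)
  obtain ⟨ω, hω⟩ := exists_light_branch (m := fun a => ENNReal.ofReal (weight s g a)) (fun a => by
    rw [← ENNReal.ofReal_add (hnn _) (hnn _), weight_cons_add]
    have h0 := den_pos a
    exact ENNReal.ofReal_le_ofReal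
      (mul_le_mul_of_nonneg_left (h _ (den_props a).2.1) (by positivity))) A w hw
  obtain ⟨π, hπ, hrec⟩ := exists_point
  have hmem : ∀ k, wordMap [] (π ω) ∈ cylinder (initial ω k) := fun k => by
    rw [wordMap_initial hrec ω k]
    exact ⟨_, hπ _, rfl⟩
  obtain ⟨n, hn⟩ := Set.mem_iUnion.1 (hU (hmem 0))
  have h1 := hA n ⟨hn, hmem 0⟩
  have h2 : A n = initial ω (A n).length :=
    eq_of_mem_cylinder (length_initial _ _).symm h1 (hmem _)
  have h3 := hω _ n h2
  have h4 : (U n).Nonempty := ⟨_, hn⟩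
  simp [w, h4] at h3

theorem le_dimH_of_le_transfer (hs : 0 < s) (hc : 0 < c) (hC : 0 ≤ C)
    (hgc : ∀ t ∈ Set.Icc (1 / 3 : ℝ) (3 / 4), c ≤ g t)
    (hgC : ∀ t ∈ Set.Icc (1 / 3 : ℝ) (3 / 4), g t ≤ C)
    (h : ∀ t ∈ Set.Icc (1 / 3 : ℝ) (3 / 4), g t ≤ transfer s g t) :
    ENNReal.ofReal s ≤ dimH E₂ := by
  have hsub : cylinder [] ⊆ E₂ := by
    rintro _ ⟨y, hy, rfl⟩
    exact branch_mem true hy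
  refine le_trans ?_ (dimH_mono hsub)
  refine le_dimH_of_hausdorffMeasure_ne_zero (d := s.toNNReal) ?_
  rw [Real.coe_toNNReal s hs.le]
  intro hzero
  have hpos : 0 < weight s g [] := by
    have h0 := den_pos []
    have h1 := hgc _ (den_props []).2.1
    exact mul_pos (by positivity) (by linarith)
  set K := ENNReal.ofReal (C * 28 ^ s)
  have key : ENNReal.ofReal (weight s g []) / K ≤ μH[s] (cylinder []) := by
    rw [hausdorffMeasure_apply]
    -- Any scale would do, since the bound holds for covers by sets of arbitrary diameter.
    refine le_iSup₂_of_le (1 : ℝ≥0∞) one_pos ?_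
    refine le_iInf fun U => le_iInf fun hU => le_iInf fun _ => ?_
    refine ENNReal.div_le_of_le_mul' ?_
    exact le_tsum_of_cover hs hC (fun t ht => hc.le.trans (hgc t ht)) hgC h U hU
  rw [hzero, nonpos_iff_eq_zero, ENNReal.div_eq_zero_iff] at key
  rcases key with key | key
  · exact absurd (ENNReal.ofReal_eq_zero.1 key) (not_le.2 hpos)
  · exact ENNReal.ofReal_ne_top key

end ContFracCantor

/-! ### The approximate eigenfunction on `[1 / 3, 3 / 4]` -/

namespace ContFracCantor

open EigenfunctionData

/-- The approximate eigenfunction in the coordinate of the continued fraction. -/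
noncomputable def trial (t : ℝ) : ℝ :=
  -- The pole at t = -2 makes the ratios (2(i+t)+1)/(t+2) affine in the new coordinate, with zeros v
  -- = -37 and v = 55 far from |v| ≤ 1.
  (t + 2) ^ (-(2 * dimValue)) * P ((9 * t - 5) / (t + 2))

theorem abs_coord_le {t : ℝ} (ht : t ∈ Set.Icc (1 / 3 : ℝ) (3 / 4)) :
    |(9 * t - 5) / (t + 2)| ≤ 1 := by
  obtain ⟨h0, h1⟩ := ht
  rw [abs_le, le_div_iff₀ (by linarith), div_le_iff₀ (by linarith)]
  constructor <;> linarith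

theorem trial_bounds {t : ℝ} (ht : t ∈ Set.Icc (1 / 3 : ℝ) (3 / 4)) :
    1 / 10 ≤ trial t ∧ trial t ≤ 2 := by
  have hP := P_bounds (abs_coord_le ht)
  have h0 : 0 < t + 2 := by linarith [ht.1]
  have h1 : (t + 2) ^ (-(2 * dimValue)) ≤ 1 :=
    Real.rpow_le_one_of_one_le_of_nonpos (by linarith [ht.1]) (by linarith [dimValue_bounds.1])
  have h2 : 1 / 9 ≤ (t + 2) ^ (-(2 * dimValue)) := by
    calc (1 / 9 : ℝ) = (3 : ℝ) ^ (-2 : ℝ) := by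
          rw [Real.rpow_neg (by norm_num), Real.rpow_two]; norm_num
      _ ≤ (t + 2) ^ (-2 : ℝ) :=
          Real.rpow_le_rpow_of_nonpos h0 (by linarith [ht.2]) (by norm_num)
      _ ≤ (t + 2) ^ (-(2 * dimValue)) :=
          Real.rpow_le_rpow_of_exponent_le (by linarith [ht.1]) (by linarith [dimValue_bounds.2])
  constructor
  · calc (1 / 10 : ℝ) ≤ 1 / 9 * (99 / 100) := by norm_num
      _ ≤ trial t := mul_le_mul h2 hP.1 (by norm_num) (by linarith)
  · calc trial t ≤ 1 * (101 / 100) := mul_le_mul h1 hP.2 (by linarith [hP.1]) (by norm_num)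
      _ ≤ 2 := by norm_num

/-- The prefactor of `trial` is a coboundary: (i+t)(1/(i+t) + 2) = 2(i+t) + 1. -/
theorem rpow_mul_trial {i t : ℝ} (hi : 1 ≤ i) (ht : t ∈ Set.Icc (1 / 3 : ℝ) (3 / 4)) :
    (i + t) ^ (-(2 * dimValue)) * trial (1 / (i + t)) =
      (t + 2) ^ (-(2 * dimValue)) * (((2 * (i + t) + 1) / (t + 2)) ^ (-(2 * dimValue)) *
        P ((9 - 5 * (i + t)) / (2 * (i + t) + 1))) := by
  have h0 : 0 < t + 2 := by linarith [ht.1]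
  have h1 : 0 < i + t := by linarith [ht.1]
  have e1 : (i + t) * (1 / (i + t) + 2) = (t + 2) * ((2 * (i + t) + 1) / (t + 2)) := by
    field_simp
    ring
  have e2 : (9 * (1 / (i + t)) - 5) / (1 / (i + t) + 2) =
      (9 - 5 * (i + t)) / (2 * (i + t) + 1) := by
    field_simp
    ring
  rw [trial, ← mul_assoc, ← mul_assoc, ← Real.mul_rpow h1.le (by positivity),
    ← Real.mul_rpow h0.le (by positivity), e1, e2]

theorem abs_trial_sub_transfer_le {t : ℝ} (ht : t ∈ Set.Icc (1 / 3 : ℝ) (3 / 4)) :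
    |trial t - transfer dimValue trial t| ≤ 2 / 10 ^ 202 * trial t := by
  have h0 : 0 < t + 2 := by linarith [ht.1]
  have hx := abs_coord_le ht
  have h := approx_eigenfunction hx
  have hP := P_bounds hx
  have e1 : (37 + (9 * t - 5) / (t + 2)) / 23 = (2 * (1 + t) + 1) / (t + 2) := by
    field_simp; ring
  have e2 : (55 - (9 * t - 5) / (t + 2)) / 23 = (2 * (2 + t) + 1) / (t + 2) := by
    field_simp; ring
  have h1 : 0 < 2 * (1 + t) + 1 := by linarith [ht.1]
  have h2 : 0 < 2 * (2 + t) + 1 := by linarith [ht.1]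
  have e3 : (11 - 14 * ((9 * t - 5) / (t + 2))) / (37 + (9 * t - 5) / (t + 2)) =
      (9 - 5 * (1 + t)) / (2 * (1 + t) + 1) := by
    rw [show 37 + (9 * t - 5) / (t + 2) = 23 * ((2 * (1 + t) + 1) / (t + 2)) by
      rw [← e1]; ring]
    field_simp; ring
  have e4 : -(34 + 9 * ((9 * t - 5) / (t + 2))) / (55 - (9 * t - 5) / (t + 2)) =
      (9 - 5 * (2 + t)) / (2 * (2 + t) + 1) := by
    rw [show 55 - (9 * t - 5) / (t + 2) = 23 * ((2 * (2 + t) + 1) / (t + 2)) by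
      rw [← e2]; ring]
    field_simp; ring
  rw [e1, e2, e3, e4] at h
  have hT : 0 < (t + 2) ^ (-(2 * dimValue)) := Real.rpow_pos_of_pos h0 _
  rw [transfer, rpow_mul_trial le_rfl ht, rpow_mul_trial one_le_two ht, trial, ← mul_add,
    ← mul_sub, abs_mul, abs_of_pos hT, mul_left_comm]
  refine mul_le_mul_of_nonneg_left (h.trans ?_) hT.le
  have h3 : (0 : ℝ) < 1 / 10 ^ 202 := by positivity
  have h4 : (2 : ℝ) / 10 ^ 202 = 2 * (1 / 10 ^ 202) := by ring
  rw [h4]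
  nlinarith [hP.1]

/-- A lower bound for the change of the factors of the transfer operator with the exponent. -/
theorem one_add_half_le_rpow {x δ : ℝ} (hx : 4 / 3 ≤ x) (hδ : 0 ≤ δ) :
    1 + δ / 2 ≤ x ^ (2 * δ) := by
  have h0 : 0 < x := by linarith
  -- From log x ≥ 1 - 1/x ≥ 1 - 3/4; the exponent 2δ then yields δ/2.
  have h1 : 1 / 4 ≤ Real.log x := by
    have := Real.one_sub_inv_le_log_of_pos h0
    have h2 : x⁻¹ ≤ (4 / 3)⁻¹ := by gcongr
    norm_num at h2
    linarith
  rw [Real.rpow_def_of_pos h0]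
  have h3 := Real.add_one_le_exp (Real.log x * (2 * δ))
  nlinarith

theorem transfer_mul_le {t δ : ℝ} (ht : t ∈ Set.Icc (1 / 3 : ℝ) (3 / 4)) (hδ : 0 ≤ δ) (d : ℝ) :
    (1 + δ / 2) * transfer (d + δ) trial t ≤ transfer d trial t := by
  have key : ∀ i : ℝ, i = 1 ∨ i = 2 →
      (1 + δ / 2) * ((i + t) ^ (-(2 * (d + δ))) * trial (1 / (i + t))) ≤
        (i + t) ^ (-(2 * d)) * trial (1 / (i + t)) := by
    intro i hi
    have hi1 : 4 / 3 ≤ i + t := by rcases hi with rfl | rfl <;> linarith [ht.1]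
    have hmem : 1 / (i + t) ∈ Set.Icc (1 / 3 : ℝ) (3 / 4) := by
      rcases hi with rfl | rfl
      · simpa [dig] using branch_mem_Icc false ht
      · simpa [dig] using branch_mem_Icc true ht
    have hg := (trial_bounds hmem).1
    have h0 : 0 < i + t := by linarith
    have e : (i + t) ^ (-(2 * d)) = (i + t) ^ (2 * δ) * (i + t) ^ (-(2 * (d + δ))) := by
      rw [← Real.rpow_add h0]; congr 1; ring
    rw [e, mul_assoc]
    exact mul_le_mul_of_nonneg_right (one_add_half_le_rpow hi1 hδ) (by positivity)
  rw [transfer, transfer, mul_add]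
  exact add_le_add (key 1 (Or.inl rfl)) (key 2 (Or.inr rfl))

theorem transfer_le_trial {t : ℝ} (ht : t ∈ Set.Icc (1 / 3 : ℝ) (3 / 4)) :
    transfer (dimValue + 1 / 10 ^ 201) trial t ≤ trial t := by
  have h1 := transfer_mul_le ht (by positivity : (0 : ℝ) ≤ 1 / 10 ^ 201) dimValue
  have h2 := (abs_le.1 (abs_trial_sub_transfer_le ht)).1
  have h3 := (trial_bounds ht).1
  have h4 : (0 : ℝ) < 1 / 10 ^ 202 := by positivity
  -- The gain 5η from the shifted exponent outweighs the defect 2η.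
  have e1 : (1 : ℝ) / 10 ^ 201 / 2 = 5 * (1 / 10 ^ 202) := by norm_num
  have e2 : (2 : ℝ) / 10 ^ 202 = 2 * (1 / 10 ^ 202) := by ring
  rw [e1] at h1
  rw [e2] at h2
  generalize transfer (dimValue + 1 / 10 ^ 201) trial t = x at *
  generalize (1 : ℝ) / 10 ^ 202 = η at *
  by_contra! hlt
  nlinarith

theorem trial_le_transfer {t : ℝ} (ht : t ∈ Set.Icc (1 / 3 : ℝ) (3 / 4)) :
    trial t ≤ transfer (dimValue - 1 / 10 ^ 201) trial t := by
  have h1 := transfer_mul_le ht (by positivity : (0 : ℝ) ≤ 1 / 10 ^ 201)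
    (dimValue - 1 / 10 ^ 201)
  rw [sub_add_cancel] at h1
  have h2 := (abs_le.1 (abs_trial_sub_transfer_le ht)).2
  have h3 := (trial_bounds ht).1
  have h4 : (0 : ℝ) < 1 / 10 ^ 202 := by positivity
  have h5 : (1 : ℝ) / 10 ^ 202 < 1 / 10 := by norm_num
  have e1 : (1 : ℝ) / 10 ^ 201 / 2 = 5 * (1 / 10 ^ 202) := by norm_num
  have e2 : (2 : ℝ) / 10 ^ 202 = 2 * (1 / 10 ^ 202) := by ring
  rw [e1] at h1
  rw [e2] at h2
  generalize transfer dimValue trial t = y at *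
  generalize (1 : ℝ) / 10 ^ 202 = η at *
  -- (1 + 5η)(1 - 2η) = 1 + η(3 - 10η), which is at least 1 because η < 1/10.
  have h6 : (1 + 5 * η) * ((1 - 2 * η) * trial t) ≤ (1 + 5 * η) * y :=
    mul_le_mul_of_nonneg_left (by linarith) (by linarith)
  have h7 : 0 ≤ η * (3 - 10 * η) * trial t :=
    mul_nonneg (mul_nonneg h4.le (by linarith)) (by linarith)
  linarith

theorem dimH_mem_Icc :
    dimH E₂ ∈ Set.Icc (ENNReal.ofReal (dimValue - 1 / 10 ^ 201))
      (ENNReal.ofReal (dimValue + 1 / 10 ^ 201)) := by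
  have hd := dimValue_bounds
  have h : (1 : ℝ) / 10 ^ 201 < 1 / 10 := by norm_num
  have h0 : (0 : ℝ) < 1 / 10 ^ 201 := by positivity
  exact ⟨le_dimH_of_le_transfer (by linarith) (by norm_num) zero_le_two
      (fun t ht => (trial_bounds ht).1) (fun t ht => (trial_bounds ht).2)
      (fun t ht => trial_le_transfer ht),
    dimH_le_of_transfer_le (by linarith) (by norm_num) (fun t ht => (trial_bounds ht).1)
      (fun t ht => transfer_le_trial ht)⟩

end ContFracCantor

theorem mainTheorem2 :
    dimH E₂ ∈ Set.Icc
      (ENNReal.ofReal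
        (0.5312805062772051416244686473684717854930591090183987798883978039275295356438313459181095701811852398804280572430751876334223893394808223090178695965328712235464299794896637840337287630454110150804519139697680713
          - 10 ^ (-201 : ℤ)))
      (ENNReal.ofReal
        (0.5312805062772051416244686473684717854930591090183987798883978039275295356438313459181095701811852398804280572430751876334223893394808223090178695965328712235464299794896637840337287630454110150804519139697680713
          + 10 ^ (-201 : ℤ))) := by
  have h : EigenfunctionData.dimValue = 0.5312805062772051416244686473684717854930591090183987798883978039275295356438313459181095701811852398804280572430751876334223893394808223090178695965328712235464299794896637840337287630454110150804519139697680713 := by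
    rw [EigenfunctionData.dimValue, EigenfunctionData.dimNum]
    norm_num
  have h1 : (10 : ℝ) ^ (-201 : ℤ) = 1 / 10 ^ 201 := by
    rw [zpow_neg, one_div]
    norm_cast
  rw [← h, h1]
  exact ContFracCantor.dimH_mem_Icc
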